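/- Let $\mathcal V$ be a two-sided quaternionic Banach space, let $\mathcal B(\mathcal V)$ be the algebra of bounded right linear (or: bounded left linear) operators on $\mathcal V$, and let $T\in\mathcal B(\mathcal V)$. Let $$\sigma_S(T)=\{s\in\mathbb H : T^2-2\,\mathrm{Re}(s)T+|s|^2\mathcal I \text{ is not invertible in } \mathcal B(\mathcal V)\},\qquad \rho_S(T)=\mathbb H\setminus\sigma_S(T)$$ be the $S$-spectrum and the $S$-resolvent set, and for $s\in\rho_S(T)$ let $$S_L^{-1}(s,T)=-(T^2-2\,\mathrm{Re}(s)T+|s|^2\mathcal I)^{-1}(T-\overline s\,\mathcal I),$$ where $s\mathcal I$ is the operator $v\mapsto sv$ in the right linear case and $v\mapsto vs$ in the left linear case (left linear operators are composed from left to right: $v(AB)=(vA)B$ in these formulas). Let $\mathbb S$ be the sphere of imaginary units and $\mathbb C_I=\mathbb R+I\mathbb R$ for $I\in\mathbb S$. A set $\Omega\subseteq\mathbb H$ is axially symmetric if with each $q$ it contains every $p$ with $\mathrm{Re}(p)=\mathrm{Re}(q)$ and $|\mathrm{Im}(p)|=|\mathrm{Im}(q)|$. An $S$-spectral set is an axially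 symmetric subset $\sigma$ of $\sigma_S(T)$ that is relatively open and closed in $\sigma_S(T)$. For such $\sigma$, the Riesz projector is $$\mathcal P(\sigma)=\frac1{2\pi}\int_{\partial(\Omega_\sigma\cap\mathbb C_I)}S_L^{-1}(s,T)\,ds_I,\qquad ds_I=-ds\,I,$$ where $I\in\mathbb S$ and $\Omega_\sigma$ is any bounded axially symmetric open set with $\Omega_\sigma\cap\sigma_S(T)=\sigma$ such that, for every $I\in\mathbb S$, $\partial(\Omega_\sigma\cap\mathbb C_I)$ lies in $\rho_S(T)$ and is a finite union of $C^1$ arcs which, positively oriented, have total winding number $1$ around the points of $\Omega_\sigma\cap\mathbb C_I$ and $0$ around the points of $\mathbb C_I$ outside its closure (for instance, finitely many piecewise $C^1$ Jordan curves). Then such an $\Omega_\sigma$ exists for every $S$-spectral set $\sigma$, the integral depends neither on $\Omega_\sigma$ nor on $I$, and for all $S$-spectral sets $\sigma,\delta$: (i) $\mathcal P(\sigma)^2=\mathcal P(\sigma)$; (ii) $T\mathcal P(\sigma)=\mathcal P(\sigma)T$; (iii) $\mathcal P(\sigma_S(T))=\mathcal I$; (iv) $\mathcal P(\emptyset)=0$;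 (v) $\mathcal P(\sigma\cup\delta)=\mathcal P(\sigma)+\mathcal P(\delta)$ if $\sigma\cap\delta=\emptyset$; (vi) $\mathcal P(\sigma\cap\delta)=\mathcal P(\sigma)\mathcal P(\delta)$. -/

import Mathlib

open scoped Quaternion
open MulOpposite

noncomputable section

namespace QuatRiesz

/-! ### Bounded quaternionic operators on a two-sided quaternionic Banach space

The left action of `ℍ[ℝ]` on `V` is `a • v`; the right action `v a` is `op a • v`. -/

section Operators

variable (V : Type*) [NormedAddCommGroup V] [NormedSpace ℝ V]
  [Module ℍ[ℝ] V] [Module ℍ[ℝ]ᵐᵒᵖ V] [SMulCommClass ℍ[ℝ] ℍ[ℝ]ᵐᵒᵖ V]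
  [IsScalarTower ℝ ℍ[ℝ] V] [IsScalarTower ℝ ℍ[ℝ]ᵐᵒᵖ V]
  [IsBoundedSMul ℍ[ℝ] V] [IsBoundedSMul ℍ[ℝ]ᵐᵒᵖ V]

/-- The algebra of bounded right linear operators on `V`: `T (v a) = (T v) a`. -/
def BoundedRight : Subalgebra ℝ (V →L[ℝ] V) where
  carrier := {f | ∀ (a : ℍ[ℝ]) (v : V), f (op a • v) = op a • f v}
  mul_mem' := by
    intro f g hf hg a v
    exact (congrArg f (hg a v)).trans (hf a (g v))
  add_mem' := by
    intro f g hf hg a v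
    exact (congrArg₂ (· + ·) (hf a v) (hg a v)).trans (smul_add _ _ _).symm
  algebraMap_mem' := by
    intro r a v
    exact smul_comm r (op a) v

/-- The algebra of bounded left linear operators on `V`: `T (a v) = a (T v)`. -/
def BoundedLeft : Subalgebra ℝ (V →L[ℝ] V) where
  carrier := {f | ∀ (a : ℍ[ℝ]) (v : V), f (a • v) = a • f v}
  mul_mem' := by
    intro f g hf hg a v
    exact (congrArg f (hg a v)).trans (hf a (g v))
  add_mem' := by
    intro f g hf hg a v
    exact (congrArg₂ (· + ·) (hf a v) (hg a v)).trans (smul_add _ _ _).symm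
  algebraMap_mem' := by
    intro r a v
    exact smul_comm r a v

/-- `s ↦ s𝓘` for right linear operators, where `(s𝓘) v = s v`. -/
def scalarRight : ℍ[ℝ] →ₐ[ℝ] BoundedRight V where
  toFun s :=
    ⟨{ toFun := fun v => s • v
       map_add' := fun v w => smul_add s v w
       map_smul' := fun r v => smul_comm s r v
       cont := continuous_const_smul s },
      fun a v => smul_comm s (op a) v⟩
  map_one' := by ext v; exact one_smul _ v
  map_mul' s t := by ext v; exact mul_smul s t v
  map_zero' := by ext v; exact zero_smul _ v
  map_add' s t := by ext v; exact add_smul s t v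
  commutes' r := by ext v; exact algebraMap_smul ℍ[ℝ] r v

/-- `s ↦ s𝓘` for left linear operators, where `v (s𝓘) = v s`.  Left linear operators act from the
right of their arguments, `v (T S) = (v T) S`, so that their algebra is the opposite one. -/
def scalarLeft : ℍ[ℝ] →ₐ[ℝ] (BoundedLeft V)ᵐᵒᵖ where
  toFun s := op
    ⟨{ toFun := fun v => op s • v
       map_add' := fun v w => smul_add (op s) v w
       map_smul' := fun r v => smul_comm (op s) r v
       cont := continuous_const_smul (op s) },
      fun a v => (smul_comm a (op s) v).symm⟩
  map_one' := by apply unop_injective; ext v; exact one_smul ℍ[ℝ]ᵐᵒᵖ v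
  map_mul' s t := by apply unop_injective; ext v; exact mul_smul (op t) (op s) v
  map_zero' := by apply unop_injective; ext v; exact zero_smul ℍ[ℝ]ᵐᵒᵖ v
  map_add' s t := by apply unop_injective; ext v; exact add_smul (op s) (op t) v
  commutes' r := by apply unop_injective; ext v; exact algebraMap_smul ℍ[ℝ]ᵐᵒᵖ r v

end Operators

/-! ### Slices and axial symmetry -/

/-- The sphere `𝕊` of imaginary units of the quaternions. -/
def imagUnits : Set ℍ[ℝ] := {I | I.re = 0 ∧ ‖I‖ = 1}

/-- The identification `u + iv ↦ u + Iv` of `ℂ` with the plane `ℂ_I`. -/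
def slicePoint (I : ℍ[ℝ]) (z : ℂ) : ℍ[ℝ] := (z.re : ℍ[ℝ]) + I * (z.im : ℍ[ℝ])

/-- `Ω ∩ ℂ_I`, as a subset of `ℂ ≅ ℂ_I`. -/
def sliceSet (I : ℍ[ℝ]) (Ω : Set ℍ[ℝ]) : Set ℂ := slicePoint I ⁻¹' Ω

/-- `Ω` contains with `q` the whole sphere `[q]`. -/
def AxiallySymmetric (Ω : Set ℍ[ℝ]) : Prop :=
  ∀ q ∈ Ω, ∀ p : ℍ[ℝ], p.re = q.re → ‖p.im‖ = ‖q.im‖ → p ∈ Ω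

/-- The `C¹` arcs `γ k : [0, 1] → ℂ` form the positively oriented boundary of the plane open set
`D`: together they trace out the topological boundary, and the winding number of their sum is `1`
around each point of `D` and `0` around each point outside the closure of `D`.
(A piecewise `C¹` Jordan curve is cut into its `C¹` arcs. The condition on the winding number fixes
the orientation, and forces the arcs to close up to cycles.) -/
structure IsOrientedBoundary (D : Set ℂ) {n : ℕ} (γ : Fin n → ℝ → ℂ) : Prop where
  contDiffOn : ∀ k, ContDiffOn ℝ 1 (γ k) (Set.Icc 0 1)
  image_eq : ⋃ k, γ k '' Set.Icc 0 1 = frontier D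
  index_inside : ∀ w ∈ D,
    ∑ k, ∫ t in (0 : ℝ)..1, deriv (γ k) t / (γ k t - w) = 2 * Real.pi * Complex.I
  index_outside : ∀ w ∉ closure D,
    ∑ k, ∫ t in (0 : ℝ)..1, deriv (γ k) t / (γ k t - w) = 0

/-! ### The S-spectrum and the Riesz projectors

`A` is the algebra of bounded quaternionic operators and `ι s` is the operator `s𝓘`; products
`B s` of an operator and a quaternion are `B * ι s`. -/

section Projectors

variable {A : Type*} [NormedRing A] [NormedAlgebra ℝ A]

/-- `T² - 2 Re(s) T + |s|² 𝓘`. -/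
def sPoly (T : A) (s : ℍ[ℝ]) : A := T ^ 2 - (2 * s.re) • T + (‖s‖ ^ 2) • (1 : A)

/-- The S-spectrum. -/
def sSpectrum (T : A) : Set ℍ[ℝ] := {s | ¬ IsUnit (sPoly T s)}

/-- The S-resolvent set. -/
def sResolventSet (T : A) : Set ℍ[ℝ] := (sSpectrum T)ᶜ

/-- The left S-resolvent operator `-(T² - 2 Re(s) T + |s|² 𝓘)⁻¹ (T - s̄𝓘)`. -/
def leftSResolvent (ι : ℍ[ℝ] →ₐ[ℝ] A) (T : A) (s : ℍ[ℝ]) : A :=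
  -(Ring.inverse (sPoly T s) * (T - ι (star s)))

/-- S-spectral sets: axially symmetric subsets of the S-spectrum that are relatively open and
closed in it. -/
structure IsSSpectralSet (T : A) (σ : Set ℍ[ℝ]) : Prop where
  subset : σ ⊆ sSpectrum T
  axiallySymmetric : AxiallySymmetric σ
  isClopen : IsClopen ((↑) ⁻¹' σ : Set (sSpectrum T))

/-- `Ω` is a bounded axially symmetric open set that contains `σ` but no other point of the
S-spectrum, the boundary of `Ω ∩ ℂ_I` lies in the S-resolvent set for every `I`, and `γ` is this
boundary, positively oriented, in the coordinate of `ℂ_I`. -/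
structure IsRieszContour (T : A) (σ Ω : Set ℍ[ℝ]) {n : ℕ} (γ : Fin n → ℝ → ℂ) : Prop where
  isOpen : IsOpen Ω
  isBounded : Bornology.IsBounded Ω
  axiallySymmetric : AxiallySymmetric Ω
  inter_sSpectrum : Ω ∩ sSpectrum T = σ
  frontier_subset : ∀ I ∈ imagUnits, ∀ z ∈ frontier (sliceSet I Ω),
    slicePoint I z ∈ sResolventSet T
  isOrientedBoundary : ∀ I ∈ imagUnits, IsOrientedBoundary (sliceSet I Ω) γ

/-- `(2π)⁻¹ ∫ S_L⁻¹(s, T) ds_I` with `ds_I = -ds I`, along the curves `γ` in the plane `ℂ_I`. -/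
def rieszIntegral (ι : ℍ[ℝ] →ₐ[ℝ] A) (T : A) (I : ℍ[ℝ]) {n : ℕ} (γ : Fin n → ℝ → ℂ) : A :=
  (1 / (2 * Real.pi)) • ∑ k, ∫ t in (0 : ℝ)..1,
    leftSResolvent ι T (slicePoint I (γ k t)) * ι (-(slicePoint I (deriv (γ k) t) * I))

/-- The Riesz projector `𝓟(σ)`: the value of the integral for some choice of `Ω` and `I`. -/
def rieszProjector (ι : ℍ[ℝ] →ₐ[ℝ] A) (T : A) (σ : Set ℍ[ℝ]) : A :=
  Classical.epsilon fun P : A => ∃ (Ω : Set ℍ[ℝ]) (n : ℕ) (γ : Fin n → ℝ → ℂ), ∃ I ∈ imagUnits,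
    IsRieszContour T σ Ω γ ∧ rieszIntegral ι T I γ = P

end Projectors

end QuatRiesz

end

/-!
The contour integral is replaced by an area integral that does not see the contour. In a complex
Banach algebra put `χ(a) = -(1/π) ∫ ∂̄χ(w) (w - a)⁻¹ dA(w)` for compactly supported `C¹` functions
`χ` that are locally constant near the spectrum of `a` (`planarCalculus`, the Helffer–Sjöstrand
formula). It only depends on the germ of `χ` along the spectrum (`planarCalculus_congr`, as total
derivatives integrate to zero), it is multiplicative (`planarCalculus_mul`, from the resolvent
equation and the Cauchy–Pompeiu formula `integral_inv_sub_smul_dbar`), and it gives `1` if `χ = 1`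
near the spectrum (`planarCalculus_eq_one`, by rescaling `χ`). If `χ` is `1` near the spectrum in
`D` and `0` near the rest of it, then `χ(a)` is the contour integral of the resolvent along the
boundary of `D` (`contourIntegral_resolvent`). The form of Stokes' theorem behind this is
`IsOrientedBoundary.sum_integral_eq`: its only input on the boundary is the winding numbers, and it
follows from Cauchy–Pompeiu and Fubini, since a `C¹` arc is a null set.

The quaternionic statement reduces to this. Let `A` be a real Banach algebra with a contractive
homomorphism `ι : ℍ → A`, and fix an imaginary unit `I`. Right multiplication by `ι (u + Iv)` makes
`A` a complex Banach space, on which left multiplication by `T` is complex linear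
(`SliceModule`, `sliceLeft`). There `T² - 2 Re(z) T + |z|² = (z - T) (z̄ - T)`, so that the spectrum
of this operator lies in the trace of the `S`-spectrum on the slice, and the `S`-resolvent is its
resolvent applied to `1` (`leftSResolvent_eq`). For cutoffs `χ` with `χ(z̄) = χ(z)` the imaginary
part of the area integral cancels, and the real part is an element of `A` that does not mention `I`
(`rieszElement`). Hence the integral over every contour in every slice is this one element
(`rieszIntegral_eq_rieszElement`), and the algebraic properties are those of the cutoffs: products
belong to intersections and sums to disjoint unions.

Contours exist because the squares of a fine grid that meet the trace of `σ` form a neighbourhood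
with an oriented boundary, symmetric about the real axis (`exists_orientedBoundary`). The right
linear operators are the case `A = BoundedRight V`, the left linear ones the case of the opposite
algebra of `BoundedLeft V`, in which the order of products is restored by `σ ∩ δ = δ ∩ σ`.
-/

noncomputable section

namespace QuatRiesz

open MeasureTheory Set Filter Topology

/-! ### The Cauchy–Riemann operator and the Cauchy–Pompeiu formula -/

section Dbar

variable {E : Type*} [NormedAddCommGroup E] [NormedSpace ℂ E]

/-- The Cauchy–Riemann operator `∂g/∂z̄ = (∂g/∂x + i ∂g/∂y) / 2`, for functions on the plane with
values in a complex normed space. -/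
def dbar (g : ℂ → E) (w : ℂ) : E :=
  (2⁻¹ : ℂ) • (fderiv ℝ g w 1 + Complex.I • fderiv ℝ g w Complex.I)

theorem continuous_dbar {g : ℂ → E} (hg : ContDiff ℝ 1 g) : Continuous (dbar g) := by
  have h := hg.continuous_fderiv one_ne_zero
  unfold dbar
  fun_prop

theorem dbar_congr {f g : ℂ → E} {w : ℂ} (h : f =ᶠ[𝓝 w] g) : dbar f w = dbar g w := by
  simp only [dbar, h.fderiv_eq]

theorem dbar_eq_zero_of_eventually_const {f : ℂ → E} {w : ℂ} {c : E} (h : ∀ᶠ z in 𝓝 w, f z = c) :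
    dbar f w = 0 := by
  rw [dbar_congr (g := fun _ => c) h]
  simp [dbar]

theorem dbar_eq_zero_of_notMem_tsupport {f : ℂ → E} {w : ℂ} (h : w ∉ tsupport f) :
    dbar f w = 0 :=
  dbar_eq_zero_of_eventually_const (c := 0) (notMem_tsupport_iff_eventuallyEq.mp h)

theorem hasCompactSupport_dbar {f : ℂ → E} (h : HasCompactSupport f) :
    HasCompactSupport (dbar f) :=
  HasCompactSupport.intro h fun _ hw => dbar_eq_zero_of_notMem_tsupport hw

theorem dbar_eq_zero_of_differentiableAt {f : ℂ → E} {w : ℂ} (h : DifferentiableAt ℂ f w) :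
    dbar f w = 0 := by
  have h' := h.fderiv_restrictScalars ℝ
  have e : fderiv ℂ f w Complex.I = Complex.I • fderiv ℂ f w 1 := by
    rw [← map_smul, smul_eq_mul, mul_one]
  simp [dbar, h', e, smul_smul]

theorem dbar_smul {f : ℂ → ℂ} {g : ℂ → E} {w : ℂ} (hf : DifferentiableAt ℝ f w)
    (hg : DifferentiableAt ℝ g w) :
    dbar (fun z => f z • g z) w = dbar f w • g w + f w • dbar g w := by
  have h : fderiv ℝ (fun z => f z • g z) w = _ := fderiv_fun_smul hf hg
  simp only [dbar, h, _root_.add_apply, _root_.smul_apply,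
    ContinuousLinearMap.smulRight_apply, smul_eq_mul]
  module

theorem dbar_sub {f g : ℂ → E} {w : ℂ} (hf : DifferentiableAt ℝ f w)
    (hg : DifferentiableAt ℝ g w) :
    dbar (fun z => f z - g z) w = dbar f w - dbar g w := by
  simp only [dbar, fderiv_fun_sub hf hg, _root_.sub_apply]
  module

theorem dbar_comp_add_right (f : ℂ → E) (w z : ℂ) :
    dbar (fun u => f (u + z)) w = dbar f (w + z) := by
  simp only [dbar, fderiv_comp_add_right]

theorem dbar_comp_smul (f : ℂ → E) (c : ℝ) (w : ℂ) (hf : Differentiable ℝ f) :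
    dbar (fun u => f (c • u)) w = (c : ℂ) • dbar f (c • w) := by
  have h : HasFDerivAt (fun u => f (c • u)) ((fderiv ℝ f (c • w)).comp
      (c • ContinuousLinearMap.id ℝ ℂ)) w :=
    (hf (c • w)).hasFDerivAt.comp w ((hasFDerivAt_id w).const_smul c)
  have h' : ∀ v, fderiv ℝ (fun u => f (c • u)) w v = c • fderiv ℝ f (c • w) v := fun v => by
    rw [h.fderiv]; simp
  simp only [dbar, h', ← Complex.coe_smul c (fderiv ℝ f (c • w) _)]
  module

/-- `∂̄` computed in the rotated frame `e, ie`, where `|e| = 1`. -/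
theorem dbar_rotated (f : ℂ → E) (w : ℂ) (θ : ℝ) :
    Complex.exp (-(θ * Complex.I)) • dbar f w = (2⁻¹ : ℂ) •
      (fderiv ℝ f w (Complex.exp (θ * Complex.I)) +
        Complex.I • fderiv ℝ f w (Complex.I * Complex.exp (θ * Complex.I))) := by
  have h1 : Complex.exp (θ * Complex.I) = Real.cos θ • (1 : ℂ) + Real.sin θ • Complex.I := by
    rw [Complex.exp_mul_I]; simp
  have h2 : Complex.I * Complex.exp (θ * Complex.I)
      = (-Real.sin θ) • (1 : ℂ) + Real.cos θ • Complex.I := by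
    rw [h1]
    simp only [Complex.real_smul]
    push_cast
    linear_combination (Complex.sin θ) * Complex.I_sq
  have h3 : Complex.exp (-(θ * Complex.I)) = (Real.cos θ : ℂ) - Real.sin θ * Complex.I := by
    rw [← neg_mul, ← Complex.ofReal_neg, Complex.exp_mul_I]
    simp [sub_eq_add_neg]
  rw [h2, h1, h3]
  simp only [map_add, map_smul, dbar]
  simp only [← Complex.coe_smul]
  match_scalars
  · ring
  · linear_combination (-1 / 2 * Complex.sin θ) * Complex.I_sq

/-- Total derivatives integrate to zero. -/
theorem integral_dbar_eq_zero {f : ℂ → E} (hf : ContDiff ℝ 1 f) (hc : HasCompactSupport f) :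
    ∫ w, dbar f w = 0 := by
  have hD := hf.continuous_fderiv one_ne_zero
  have hi : ∀ v : ℂ, Integrable fun w => fderiv ℝ f w v := fun v =>
    Continuous.integrable_of_hasCompactSupport (by fun_prop) ((hc.fderiv ℝ).mono' (by
      intro w hw
      refine subset_tsupport _ fun h => hw ?_
      simp [h]))
  have h0 : ∀ v : ℂ, ∫ w, fderiv ℝ f w v = 0 := by
    intro v
    have := integral_smul_fderiv_eq_neg_fderiv_smul_of_integrable (μ := volume) (𝕜 := ℝ) (v := v)
      (f := fun _ : ℂ => (1 : ℝ)) (g := f) (by simp) (by simpa using hi v)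
      (by simpa using hf.continuous.integrable_of_hasCompactSupport hc)
      (fun x _ => by fun_prop) (fun x _ => hf.differentiable one_ne_zero x)
    simpa using this
  simp only [dbar]
  have h1 : Integrable fun w => Complex.I • fderiv ℝ f w Complex.I := (hi _).smul _
  rw [integral_smul, integral_add (hi 1) h1, integral_smul, h0, h0]
  simp

variable [CompleteSpace E]

open Complex in
/-- The Cauchy–Pompeiu formula at the origin. -/
theorem integral_inv_smul_dbar_zero {f : ℂ → E} (hf : ContDiff ℝ 1 f) (hc : HasCompactSupport f) :
    ∫ w, w⁻¹ • dbar f w = -(Real.pi : ℂ) • f 0 := by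
  -- In polar coordinates `2 e^{-iθ} ∂̄f = ∂f/∂r + (i/r) ∂f/∂θ`: the first term integrates to
  -- `-f 0` along each ray, and the second one to `0` along each circle.
  obtain ⟨R, hR⟩ := hc.isCompact.isBounded.subset_closedBall 0
  have hD := hf.continuous_fderiv one_ne_zero
  set A : ℝ × ℝ → E := fun p => fderiv ℝ f (p.1 * exp (p.2 * I)) (exp (p.2 * I)) with hA
  set B : ℝ × ℝ → E := fun p => I • fderiv ℝ f (p.1 * exp (p.2 * I)) (I * exp (p.2 * I)) with hB
  have hAc : Continuous A := by fun_prop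
  have hBc : Continuous B := by fun_prop
  have hzero : ∀ p : ℝ × ℝ, R < p.1 → fderiv ℝ f (p.1 * exp (p.2 * I)) = 0 := by
    intro p hp
    by_contra h
    have h1 := hR (support_fderiv_subset ℝ h)
    rw [mem_closedBall_zero_iff, norm_mul, norm_exp_ofReal_mul_I, mul_one, norm_real,
      Real.norm_eq_abs] at h1
    exact absurd (le_abs_self p.1) (by linarith)
  have hint : ∀ F : ℝ × ℝ → E, Continuous F → (∀ p : ℝ × ℝ, R < p.1 → F p = 0) →
      IntegrableOn F (Ioi 0 ×ˢ Ioo (-Real.pi) Real.pi) := by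
    intro F hF h0
    refine IntegrableOn.of_forall_sdiff_eq_zero (s := Icc 0 R ×ˢ Icc (-Real.pi) Real.pi)
      (hF.continuousOn.integrableOn_compact (isCompact_Icc.prod isCompact_Icc))
      (measurableSet_Ioi.prod measurableSet_Ioo) ?_
    rintro p ⟨⟨hp1, hp2⟩, hp3⟩
    refine h0 p (not_le.mp fun h => hp3 ⟨⟨le_of_lt hp1, h⟩, Ioo_subset_Icc_self hp2⟩)
  have hAi := hint A hAc fun p hp => by simp [hA, hzero p hp]
  have hBi := hint B hBc fun p hp => by simp [hB, hzero p hp]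
  have hcirc : ∀ r θ : ℝ, HasDerivAt (fun θ : ℝ => f (r * exp (θ * I)))
      (fderiv ℝ f (r * exp (θ * I)) (r * (I * exp (θ * I)))) θ := by
    intro r θ
    have h1 : HasDerivAt (fun θ : ℝ => (r : ℂ) * exp (θ * I)) (r * (I * exp (θ * I))) θ := by
      have h2 := (((hasDerivAt_id θ).ofReal_comp.mul_const I).cexp).const_mul (r : ℂ)
      refine h2.congr_deriv ?_
      simp [mul_comm]
    exact ((hf.differentiable one_ne_zero _).hasFDerivAt).comp_hasDerivAt θ h1
  have hray : ∀ r θ : ℝ, HasDerivAt (fun r : ℝ => f (r * exp (θ * I)))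
      (fderiv ℝ f (r * exp (θ * I)) (exp (θ * I))) r := by
    intro r θ
    have h1 : HasDerivAt (fun r : ℝ => (r : ℂ) * exp (θ * I)) (exp (θ * I)) r := by
      simpa using ((hasDerivAt_id r).ofReal_comp.mul_const (exp (θ * I)))
    exact ((hf.differentiable one_ne_zero _).hasFDerivAt).comp_hasDerivAt r h1
  have hIA : ∫ p in Ioi 0 ×ˢ Ioo (-Real.pi) Real.pi, A p = -(2 * Real.pi : ℂ) • f 0 := by
    rw [IntegrableOn, Measure.volume_eq_prod, ← Measure.prod_restrict] at hAi
    rw [Measure.volume_eq_prod, ← Measure.prod_restrict, integral_prod_symm _ hAi]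
    have h1 : ∀ θ : ℝ, ∫ r in Ioi (0 : ℝ), A (r, θ) = - f 0 := by
      intro θ
      have h2 := integral_Ioi_of_hasDerivAt_of_tendsto (a := 0) (m := (0 : E))
        (f := fun r : ℝ => f (r * exp (θ * I))) (f' := fun r => A (r, θ))
        (by have := hf.continuous; fun_prop) (fun r _ => hray r θ) ?_ ?_
      · simpa using h2
      · refine IntegrableOn.of_forall_sdiff_eq_zero (s := Icc 0 R)
          (Continuous.continuousOn (by fun_prop) |>.integrableOn_compact isCompact_Icc)
          measurableSet_Ioi ?_
        rintro r ⟨hr1, hr2⟩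
        simp [hA, hzero (r, θ) (not_le.mp fun h => hr2 ⟨le_of_lt hr1, h⟩)]
      · refine tendsto_const_nhds.congr' ?_
        filter_upwards [eventually_gt_atTop R] with r hr
        by_contra h
        have h1 := hR (subset_tsupport f (Ne.symm h))
        rw [mem_closedBall_zero_iff, norm_mul, norm_exp_ofReal_mul_I, mul_one, norm_real,
          Real.norm_eq_abs] at h1
        exact absurd (le_abs_self r) (by linarith)
    simp only [h1, integral_const, MeasurableSet.univ, measureReal_restrict_apply, univ_inter]
    rw [Real.volume_real_Ioo_of_le (by linarith [Real.pi_pos]), ← Complex.coe_smul]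
    push_cast
    module
  have hIB : ∫ p in Ioi 0 ×ˢ Ioo (-Real.pi) Real.pi, B p = 0 := by
    rw [Measure.volume_eq_prod, setIntegral_prod _ hBi]
    refine setIntegral_eq_zero_of_forall_eq_zero fun r hr => ?_
    have hr' : (r : ℂ) ≠ 0 := by exact_mod_cast (ne_of_gt hr)
    have h1 := intervalIntegral.integral_eq_sub_of_hasDerivAt (a := -Real.pi) (b := Real.pi)
      (fun θ _ => hcirc r θ) (Continuous.intervalIntegrable (by fun_prop) _ _)
    rw [intervalIntegral.integral_of_le (by linarith [Real.pi_pos]),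
      integral_Ioc_eq_integral_Ioo] at h1
    have h2 : ∀ θ : ℝ, B (r, θ) = (I * (r : ℂ)⁻¹) •
        fderiv ℝ f (r * exp (θ * I)) (r * (I * exp (θ * I))) := by
      intro θ
      have h3 : (r : ℂ) * (I * exp (θ * I)) = r • (I * exp (θ * I)) := by simp
      simp only [hB]
      rw [h3, map_smul, ← Complex.coe_smul, smul_smul, mul_assoc, inv_mul_cancel₀ hr', mul_one]
    simp only [h2]
    rw [integral_smul, h1]
    rw [ofReal_neg, neg_mul, exp_neg, exp_pi_mul_I]
    simp [inv_neg]
  rw [← Complex.integral_comp_polarCoord_symm, polarCoord_target]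
  have hcongr : ∀ p ∈ Ioi (0 : ℝ) ×ˢ Ioo (-Real.pi) Real.pi,
      p.1 • ((Complex.polarCoord.symm p)⁻¹ • dbar f (Complex.polarCoord.symm p))
        = (2⁻¹ : ℂ) • (A p + B p) := by
    rintro p ⟨hp, -⟩
    have hp' : (p.1 : ℂ) ≠ 0 := by exact_mod_cast (ne_of_gt hp)
    have h1 : Complex.polarCoord.symm p = p.1 * exp (p.2 * I) := by
      rw [Complex.polarCoord_symm_apply, exp_mul_I]; simp
    rw [h1, ← dbar_rotated, ← Complex.coe_smul, smul_smul, mul_inv, ← mul_assoc,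
      mul_inv_cancel₀ hp', one_mul, exp_neg]
  rw [setIntegral_congr_fun (measurableSet_Ioi.prod measurableSet_Ioo) hcongr, integral_smul,
    integral_add hAi hBi, hIA, hIB]
  match_scalars
  ring

/-- The Cauchy–Pompeiu formula for compactly supported functions. -/
theorem integral_inv_sub_smul_dbar {f : ℂ → E} (hf : ContDiff ℝ 1 f) (hc : HasCompactSupport f)
    (z : ℂ) : ∫ w, (w - z)⁻¹ • dbar f w = -(Real.pi : ℂ) • f z := by
  have h := integral_inv_smul_dbar_zero (f := fun u => f (u + z))
    (hf.comp (contDiff_id.add contDiff_const)) (hc.comp_homeomorph (Homeomorph.addRight z))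
  simp only [dbar_comp_add_right, zero_add] at h
  rw [← h, ← integral_add_right_eq_self _ z]
  simp

end Dbar

/-! ### The Cauchy kernel and Stokes' theorem for winding numbers -/

section Kernel

variable {F G : Type*} [NormedAddCommGroup F] [NormedAddCommGroup G]

theorem integrable_indicator_norm_inv :
    Integrable fun u : ℂ => (Iio (1 : ℝ)).indicator (fun r => r⁻¹) ‖u‖ := by
  rw [integrable_fun_norm_addHaar volume (f := (Iio (1 : ℝ)).indicator fun r => r⁻¹)]
  refine IntegrableOn.of_forall_sdiff_eq_zero (s := Ioo 0 1) ?_ measurableSet_Ioi ?_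
  · refine (integrableOn_const (C := (1 : ℝ)) (by simp)).congr_fun (fun r hr => ?_)
      measurableSet_Ioo
    have h0 : r ≠ 0 := ne_of_gt hr.1
    simp [Complex.finrank_real_complex, hr.2, h0]
  · rintro r ⟨hr1, hr2⟩
    have : r ∉ Iio (1 : ℝ) := fun h => hr2 ⟨hr1, h⟩
    simp [indicator_of_notMem this]

/-- The Cauchy kernel is bounded by an integrable kernel near its pole and by `1` away from it. -/
theorem norm_inv_mul_le (φ : ℂ → F) {M : ℝ} (hM : ∀ w, ‖φ w‖ ≤ M) (w z : ℂ) :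
    ‖w - z‖⁻¹ * ‖φ w‖ ≤ M * (Iio (1 : ℝ)).indicator (fun r => r⁻¹) ‖w - z‖ + ‖φ w‖ := by
  by_cases h : ‖w - z‖ < 1
  · rw [indicator_of_mem (show ‖w - z‖ ∈ Iio (1 : ℝ) from h), mul_comm]
    have := mul_le_mul_of_nonneg_right (hM w) (inv_nonneg.mpr (norm_nonneg (w - z)))
    linarith [norm_nonneg (φ w)]
  · rw [indicator_of_notMem (show ‖w - z‖ ∉ Iio (1 : ℝ) from h), mul_zero, zero_add]
    exact mul_le_of_le_one_left (norm_nonneg _) (inv_le_one_of_one_le₀ (not_lt.mp h))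

theorem integrable_norm_inv_sub_mul {φ : ℂ → F} (hφ : Continuous φ) (hc : HasCompactSupport φ)
    (z : ℂ) : Integrable fun w => ‖w - z‖⁻¹ * ‖φ w‖ := by
  obtain ⟨M, hM⟩ := hφ.bounded_above_of_compact_support hc
  refine ((integrable_indicator_norm_inv.comp_sub_right z).const_mul M |>.add
    (hφ.integrable_of_hasCompactSupport hc).norm).mono' ?_ (ae_of_all _ fun w => ?_)
  · exact (Measurable.aestronglyMeasurable (by fun_prop)).mul hφ.norm.aestronglyMeasurable
  · rw [Real.norm_of_nonneg (by positivity)]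
    exact norm_inv_mul_le φ hM w z

/-- The Cauchy kernel is locally integrable, uniformly in its pole. -/
theorem exists_integral_norm_inv_sub_mul_le {φ : ℂ → F} (hφ : Continuous φ)
    (hc : HasCompactSupport φ) : ∃ C : ℝ, ∀ z, ∫ w, ‖w - z‖⁻¹ * ‖φ w‖ ≤ C := by
  obtain ⟨M, hM⟩ := hφ.bounded_above_of_compact_support hc
  have h1 := fun z : ℂ => (integrable_indicator_norm_inv.comp_sub_right z).const_mul M
  have h2 := (hφ.integrable_of_hasCompactSupport (μ := volume) hc).norm
  refine ⟨M * (∫ u : ℂ, (Iio (1 : ℝ)).indicator (fun r => r⁻¹) ‖u‖) + ∫ w, ‖φ w‖, fun z => ?_⟩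
  refine (integral_mono (integrable_norm_inv_sub_mul hφ hc z) ((h1 z).add h2)
    fun w => norm_inv_mul_le φ hM w z).trans (le_of_eq ?_)
  simp only [Pi.add_apply]
  rw [integral_add (h1 z) h2, integral_const_mul,
    integral_sub_right_eq_self (fun u : ℂ => (Iio (1 : ℝ)).indicator (fun r => r⁻¹) ‖u‖)]

/-- Integrability on the product, which justifies Fubini for the Cauchy kernel. -/
theorem integrable_prod_norm_inv_sub {X : Type*} [MeasurableSpace X] {ν : Measure X} [SFinite ν]
    {u : X → ℂ} {c : X → F} {φ : ℂ → G} (hu : AEMeasurable u ν) (hc : Integrable c ν)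
    (hφ : Continuous φ) (hs : HasCompactSupport φ) :
    Integrable (fun p : X × ℂ => ‖c p.1‖ * (‖p.2 - u p.1‖⁻¹ * ‖φ p.2‖)) (ν.prod volume) := by
  obtain ⟨C, hC⟩ := exists_integral_norm_inv_sub_mul_le hφ hs
  have hm : AEStronglyMeasurable (fun p : X × ℂ => ‖c p.1‖ * (‖p.2 - u p.1‖⁻¹ * ‖φ p.2‖))
      (ν.prod volume) := by
    have h1 : AEStronglyMeasurable (fun p : X × ℂ => c p.1) (ν.prod volume) :=
      hc.aestronglyMeasurable.comp_fst
    have h2 : AEMeasurable (fun p : X × ℂ => u p.1) (ν.prod volume) := hu.comp_fst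
    have h3 : AEMeasurable (fun p : X × ℂ => ‖p.2 - u p.1‖⁻¹) (ν.prod volume) :=
      (measurable_snd.aemeasurable.sub h2).norm.inv
    exact h1.norm.mul (h3.aestronglyMeasurable.mul
      hφ.norm.aestronglyMeasurable.comp_snd)
  rw [integrable_prod_iff hm]
  refine ⟨ae_of_all _ fun x => (integrable_norm_inv_sub_mul hφ hs (u x)).const_mul ‖c x‖, ?_⟩
  refine (hc.norm.mul_const C).mono' hm.norm.integral_prod_right' (ae_of_all _ fun x => ?_)
  rw [Real.norm_of_nonneg (integral_nonneg fun w => norm_nonneg _)]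
  have : ∀ w : ℂ, ‖‖c x‖ * (‖w - u x‖⁻¹ * ‖φ w‖)‖ = ‖c x‖ * (‖w - u x‖⁻¹ * ‖φ w‖) := fun w =>
    Real.norm_of_nonneg (by positivity)
  simp only [this]
  rw [integral_const_mul]
  exact mul_le_mul_of_nonneg_left (hC _) (norm_nonneg _)

end Kernel

/-- A `C¹` arc has Hausdorff dimension at most `1`, hence no area. -/
theorem volume_image_Icc_eq_zero {γ : ℝ → ℂ} (h : ContDiffOn ℝ 1 γ (Icc 0 1)) :
    volume (γ '' Icc 0 1) = 0 := by
  have h1 : dimH (γ '' Icc 0 1) < (2 : NNReal) :=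
    calc dimH (γ '' Icc 0 1) ≤ dimH (Icc (0 : ℝ) 1) := h.dimH_image_le (convex_Icc 0 1) subset_rfl
      _ ≤ dimH (univ : Set ℝ) := dimH_mono (subset_univ _)
      _ = 1 := Real.dimH_univ
      _ < (2 : NNReal) := by norm_num
  have h2 : (volume : Measure ℂ) ≪ μH[((2 : NNReal) : ℝ)] := by
    have := isAddHaarMeasure_hausdorffMeasure (E := ℂ)
    rw [Complex.finrank_real_complex] at this
    change (volume : Measure ℂ) ≪ μH[((2 : ℕ) : ℝ)]
    exact Measure.absolutelyContinuous_isAddHaarMeasure _ _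
  exact measure_zero_of_dimH_lt h2 h1

theorem intervalIntegrable_deriv {γ : ℝ → ℂ} (h : ContDiffOn ℝ 1 γ (Icc 0 1)) :
    IntervalIntegrable (deriv γ) volume 0 1 := by
  have h1 := h.continuousOn_derivWithin (uniqueDiffOn_Icc zero_lt_one) le_rfl
  -- at the two endpoints `deriv γ` may be a junk value, which the integral does not see
  rw [intervalIntegrable_iff_integrableOn_Ioo_of_le zero_le_one]
  refine ((h1.integrableOn_compact isCompact_Icc).mono_set Ioo_subset_Icc_self).congr_fun
    (fun t ht => derivWithin_of_mem_nhds (Icc_mem_nhds ht.1 ht.2)) measurableSet_Ioo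

section Stokes

variable {E : Type*} [NormedAddCommGroup E] [NormedSpace ℂ E] [CompleteSpace E]

/-- The integral of a compactly supported function along an arc, as an area integral against the
Cauchy transform of the arc: insert the Cauchy–Pompeiu formula and exchange the integrals. No
regularity of the trace of the arc is needed. -/
theorem integral_deriv_smul_comp {γ : ℝ → ℂ} (h : ContDiffOn ℝ 1 γ (Icc 0 1)) {g : ℂ → E}
    (hg : ContDiff ℝ 1 g) (hc : HasCompactSupport g) :
    (Integrable fun w => (∫ t in (0 : ℝ)..1, deriv γ t / (γ t - w)) • dbar g w) ∧
    ∫ t in (0 : ℝ)..1, deriv γ t • g (γ t) =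
      (Real.pi : ℂ)⁻¹ • ∫ w, (∫ t in (0 : ℝ)..1, deriv γ t / (γ t - w)) • dbar g w := by
  set ν : Measure ℝ := volume.restrict (Ioc 0 1) with hν
  have hπ : (Real.pi : ℂ) ≠ 0 := by exact_mod_cast Real.pi_ne_zero
  have hd : Integrable (deriv γ) ν :=
    (intervalIntegrable_iff_integrableOn_Ioc_of_le zero_le_one).mp (intervalIntegrable_deriv h)
  have hγ : AEMeasurable γ ν :=
    (h.continuousOn.mono Ioc_subset_Icc_self).aemeasurable measurableSet_Ioc
  have hφ := continuous_dbar hg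
  have hφc := hasCompactSupport_dbar hc
  have hI : Integrable (fun p : ℝ × ℂ => (deriv γ p.1 / (γ p.1 - p.2)) • dbar g p.2)
      (ν.prod volume) := by
    refine (integrable_prod_norm_inv_sub hγ hd hφ hφc).mono' ?_ (ae_of_all _ fun p => ?_)
    · have h1 : AEMeasurable (fun p : ℝ × ℂ => deriv γ p.1) (ν.prod volume) :=
        hd.aestronglyMeasurable.aemeasurable.comp_fst
      have h2 : AEMeasurable (fun p : ℝ × ℂ => γ p.1) (ν.prod volume) := hγ.comp_fst
      exact (h1.div (h2.sub measurable_snd.aemeasurable)).aestronglyMeasurable.smul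
        hφ.aestronglyMeasurable.comp_snd
    · rw [norm_smul, norm_div, norm_sub_rev, div_eq_mul_inv, mul_assoc]
  simp only [intervalIntegral.integral_of_le zero_le_one]
  have hsw := integral_integral_swap (f := fun t w => (deriv γ t / (γ t - w)) • dbar g w) hI
  simp only [integral_smul_const] at hsw
  refine ⟨?_, ?_⟩
  · simpa only [integral_smul_const] using hI.integral_prod_right
  · rw [← hsw, ← integral_smul]
    refine integral_congr_ae (ae_of_all _ fun t => ?_)
    have h1 : ∀ w, (deriv γ t / (γ t - w)) • dbar g w
        = (-deriv γ t) • ((w - γ t)⁻¹ • dbar g w) := fun w => by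
      rw [smul_smul, ← neg_sub w (γ t), div_neg, div_eq_mul_inv, neg_mul]
    simp only [h1]
    rw [integral_smul, integral_inv_sub_smul_dbar hg hc, smul_smul, smul_smul]
    congr 1
    field_simp

/-- The complex form of Stokes' theorem on a plane open set whose boundary is only described by
winding numbers: these are the Cauchy transform of the boundary, off the boundary itself, which is
a null set. -/
theorem IsOrientedBoundary.sum_integral_eq {D : Set ℂ} {n : ℕ} {γ : Fin n → ℝ → ℂ}
    (h : IsOrientedBoundary D γ) (hD : IsOpen D) {g : ℂ → E} (hg : ContDiff ℝ 1 g)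
    (hc : HasCompactSupport g) :
    ∑ k, ∫ t in (0 : ℝ)..1, deriv (γ k) t • g (γ k t) = (2 * Complex.I) • ∫ w in D, dbar g w := by
  have hπ : (Real.pi : ℂ) ≠ 0 := by exact_mod_cast Real.pi_ne_zero
  have h0 : volume (frontier D) = 0 := by
    rw [← h.image_eq]
    exact measure_iUnion_null fun k => volume_image_Icc_eq_zero (h.contDiffOn k)
  have h1 := fun k => integral_deriv_smul_comp (h.contDiffOn k) hg hc
  simp only [fun k => (h1 k).2]
  rw [← Finset.smul_sum, ← integral_finsetSum _ fun k _ => (h1 k).1,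
    ← integral_indicator hD.measurableSet, ← integral_smul, ← integral_smul]
  refine integral_congr_ae ?_
  filter_upwards [compl_mem_ae_iff.mpr h0] with w hw
  rw [← Finset.sum_smul]
  by_cases hwD : w ∈ D
  · rw [h.index_inside w hwD, indicator_of_mem hwD, smul_smul]
    congr 1
    field_simp
  · have : w ∉ closure D := fun h' => hw ⟨h', fun h'' => hwD (interior_subset h'')⟩
    rw [h.index_outside w this, indicator_of_notMem hwD]
    simp

end Stokes

/-! ### The planar functional calculus -/

section Calculus

variable {B : Type*} [NormedRing B] [NormedAlgebra ℂ B]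

/-- The operator `χ(a)` of the Helffer–Sjöstrand functional calculus,
`-(1/π) ∫ ∂̄χ(w) (w - a)⁻¹ dA(w)`, for functions `χ` that are locally constant near the spectrum
of `a`. The junk value of `resolvent a` on the spectrum is multiplied by `∂̄χ = 0`. -/
def planarCalculus (a : B) (χ : ℂ → ℂ) : B :=
  (-(Real.pi : ℂ)⁻¹) • ∫ w, dbar χ w • resolvent a w

/-- The functions to which the calculus of `a` is applied: compactly supported `C¹` functions that
are locally constant near the spectrum of `a`. -/
structure IsCutoff (a : B) (χ : ℂ → ℂ) : Prop where
  contDiff : ContDiff ℝ 1 χ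
  hasCompactSupport : HasCompactSupport χ
  eventually_eq : ∀ z ∈ spectrum ℂ a, ∀ᶠ w in 𝓝 z, χ w = χ z

theorem IsCutoff.mul {a : B} {χ ψ : ℂ → ℂ} (hχ : IsCutoff a χ) (hψ : IsCutoff a ψ) :
    IsCutoff a (fun w => χ w * ψ w) where
  contDiff := hχ.contDiff.mul hψ.contDiff
  hasCompactSupport := hχ.hasCompactSupport.mul_right
  eventually_eq z hz := by
    filter_upwards [hχ.eventually_eq z hz, hψ.eventually_eq z hz] with w h1 h2
    rw [h1, h2]

theorem IsCutoff.dbar_eventually_eq {a : B} {χ : ℂ → ℂ} (hχ : IsCutoff a χ) {z : ℂ}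
    (hz : z ∈ spectrum ℂ a) : ∀ᶠ w in 𝓝 z, dbar χ w = 0 := by
  filter_upwards [(hχ.eventually_eq z hz).eventually_nhds] with w hw
  exact dbar_eq_zero_of_eventually_const hw

theorem IsCutoff.hasCompactSupport_dbar_smul {a : B} {χ : ℂ → ℂ} (hχ : IsCutoff a χ) :
    HasCompactSupport (fun w => dbar χ w • resolvent a w) :=
  (hasCompactSupport_dbar hχ.hasCompactSupport).smul_right

/-- The resolvent equation. -/
theorem resolvent_mul_resolvent {a : B} {w z : ℂ} (hw : w ∉ spectrum ℂ a)
    (hz : z ∉ spectrum ℂ a) (h : z - w ≠ 0) :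
    resolvent a w * resolvent a z = (z - w)⁻¹ • (resolvent a w - resolvent a z) := by
  have hw' : IsUnit (algebraMap ℂ B w - a) := not_not.mp hw
  have hz' : IsUnit (algebraMap ℂ B z - a) := not_not.mp hz
  rw [eq_inv_smul_iff₀ h]
  have h1 : (z - w) • (1 : B) = (algebraMap ℂ B z - a) - (algebraMap ℂ B w - a) := by
    simp [Algebra.algebraMap_eq_smul_one, sub_smul]
  calc (z - w) • (resolvent a w * resolvent a z)
      = resolvent a w * ((z - w) • (1 : B)) * resolvent a z := by simp
    _ = resolvent a w * ((algebraMap ℂ B z - a) * resolvent a z)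
        - (resolvent a w * (algebraMap ℂ B w - a)) * resolvent a z := by rw [h1]; noncomm_ring
    _ = _ := by
      rw [resolvent, resolvent, Ring.mul_inverse_cancel _ hz', Ring.inverse_mul_cancel _ hw',
        mul_one, one_mul]

theorem commute_resolvent (a : B) (w : ℂ) : Commute a (resolvent a w) := by
  by_cases h : IsUnit (algebraMap ℂ B w - a)
  · obtain ⟨u, hu⟩ := h
    rw [resolvent, ← hu, Ring.inverse_unit]
    refine Commute.units_inv_right ?_
    rw [hu]
    exact Commute.sub_right (Algebra.commutes w a).symm (Commute.refl a)
  · rw [resolvent, Ring.inverse_non_unit _ h]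
    exact Commute.zero_right a

variable [CompleteSpace B]

theorem differentiableAt_resolvent {a : B} {z : ℂ} (hz : z ∉ spectrum ℂ a) :
    DifferentiableAt ℂ (resolvent a) z :=
  (spectrum.hasDerivAt_resolvent_const_left (not_not.mp hz)).differentiableAt

theorem contDiffAt_resolvent {a : B} {z : ℂ} (hz : z ∉ spectrum ℂ a) :
    ContDiffAt ℝ 1 (resolvent a) z := by
  have h1 : DifferentiableOn ℂ (resolvent a) (spectrum ℂ a)ᶜ := fun w hw =>
    (differentiableAt_resolvent hw).differentiableWithinAt
  have h2 := (spectrum.isClosed a (𝕜 := ℂ)).isOpen_compl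
  exact ((h1.contDiffOn h2).contDiffAt (h2.mem_nhds hz)).restrict_scalars ℝ

/-- Multiplication by a function that vanishes near the spectrum extends the resolvent smoothly
across the spectrum. -/
theorem contDiff_smul_resolvent {a : B} {h : ℂ → ℂ} (hh : ContDiff ℝ 1 h)
    (h0 : ∀ z ∈ spectrum ℂ a, ∀ᶠ w in 𝓝 z, h w = 0) :
    ContDiff ℝ 1 (fun w => h w • resolvent a w) := by
  rw [contDiff_iff_contDiffAt]
  intro z
  by_cases hz : z ∈ spectrum ℂ a
  · refine (contDiffAt_const (c := (0 : B))).congr_of_eventuallyEq ?_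
    filter_upwards [h0 z hz] with w hw
    rw [hw, zero_smul]
  · exact hh.contDiffAt.smul (contDiffAt_resolvent hz)

theorem continuous_smul_resolvent {a : B} {φ : ℂ → ℂ} (hφ : Continuous φ)
    (h0 : ∀ z ∈ spectrum ℂ a, ∀ᶠ w in 𝓝 z, φ w = 0) :
    Continuous (fun w => φ w • resolvent a w) := by
  rw [continuous_iff_continuousAt]
  intro z
  by_cases hz : z ∈ spectrum ℂ a
  · refine (continuousAt_const (y := (0 : B))).congr ?_
    filter_upwards [h0 z hz] with w hw
    rw [hw, zero_smul]
  · exact hφ.continuousAt.smul (differentiableAt_resolvent hz).continuousAt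

theorem dbar_smul_resolvent {a : B} {h : ℂ → ℂ} (hh : ContDiff ℝ 1 h)
    (h0 : ∀ z ∈ spectrum ℂ a, ∀ᶠ w in 𝓝 z, h w = 0) (w : ℂ) :
    dbar (fun w => h w • resolvent a w) w = dbar h w • resolvent a w := by
  by_cases hw : w ∈ spectrum ℂ a
  · rw [dbar_eq_zero_of_eventually_const (h0 w hw), dbar_eq_zero_of_eventually_const (c := 0),
      zero_smul]
    filter_upwards [h0 w hw] with z hz
    rw [hz, zero_smul]
  · have h1 := differentiableAt_resolvent hw
    rw [dbar_smul (hh.differentiable one_ne_zero w) (h1.restrictScalars ℝ),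
      dbar_eq_zero_of_differentiableAt h1, smul_zero, add_zero]

theorem IsCutoff.continuous_dbar_smul {a : B} {χ : ℂ → ℂ} (hχ : IsCutoff a χ) :
    Continuous (fun w => dbar χ w • resolvent a w) :=
  continuous_smul_resolvent (continuous_dbar hχ.contDiff) fun _ hz => hχ.dbar_eventually_eq hz

theorem IsCutoff.integrable {a : B} {χ : ℂ → ℂ} (hχ : IsCutoff a χ) :
    Integrable (fun w => dbar χ w • resolvent a w) :=
  hχ.continuous_dbar_smul.integrable_of_hasCompactSupport hχ.hasCompactSupport_dbar_smul

/-- The calculus only depends on the germ of the function along the spectrum. -/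
theorem planarCalculus_congr {a : B} {χ ψ : ℂ → ℂ} (hχ : IsCutoff a χ) (hψ : IsCutoff a ψ)
    (h : ∀ z ∈ spectrum ℂ a, ∀ᶠ w in 𝓝 z, χ w = ψ w) :
    planarCalculus a χ = planarCalculus a ψ := by
  have h0 : ∀ z ∈ spectrum ℂ a, ∀ᶠ w in 𝓝 z, χ w - ψ w = 0 := fun z hz => by
    filter_upwards [h z hz] with w hw
    rw [hw, sub_self]
  have hd := hχ.contDiff.sub hψ.contDiff
  have h1 := integral_dbar_eq_zero (contDiff_smul_resolvent hd h0)
    (hχ.hasCompactSupport.sub hψ.hasCompactSupport).smul_right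
  simp only [dbar_smul_resolvent hd h0] at h1
  have h2 : ∀ w, dbar (fun w => χ w - ψ w) w • resolvent a w
      = dbar χ w • resolvent a w - dbar ψ w • resolvent a w := fun w => by
    rw [dbar_sub (hχ.contDiff.differentiable one_ne_zero w)
      (hψ.contDiff.differentiable one_ne_zero w), sub_smul]
  simp only [h2] at h1
  rw [integral_sub hχ.integrable hψ.integrable, sub_eq_zero] at h1
  rw [planarCalculus, planarCalculus, h1]

theorem commute_planarCalculus {a : B} {χ : ℂ → ℂ} (hχ : IsCutoff a χ) :
    Commute a (planarCalculus a χ) := by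
  refine Commute.smul_right ?_ _
  have h2 := (ContinuousLinearMap.mul ℂ B a).integral_comp_comm hχ.integrable
  have h3 := ((ContinuousLinearMap.mul ℂ B).flip a).integral_comp_comm hχ.integrable
  simp only [ContinuousLinearMap.mul_apply', ContinuousLinearMap.flip_apply] at h2 h3
  rw [Commute, SemiconjBy, ← h2, ← h3]
  congr 1
  ext w
  rw [mul_smul_comm, smul_mul_assoc, (commute_resolvent a w).eq]

/-- Multiplicativity of the calculus: the resolvent equation splits the double integral into two,
and the Cauchy–Pompeiu formula evaluates one variable in each. -/
theorem planarCalculus_mul {a : B} {χ ψ : ℂ → ℂ} (hχ : IsCutoff a χ) (hψ : IsCutoff a ψ) :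
    planarCalculus a (fun w => χ w * ψ w) = planarCalculus a χ * planarCalculus a ψ := by
  have hπ : (Real.pi : ℂ) ≠ 0 := by exact_mod_cast Real.pi_ne_zero
  set f : ℂ → B := fun w => dbar χ w • resolvent a w with hf
  set g : ℂ → B := fun z => dbar ψ z • resolvent a z with hg
  have hfi : Integrable f := hχ.integrable
  have hgi : Integrable g := hψ.integrable
  have hgc : Continuous g := hψ.continuous_dbar_smul
  have hgs : HasCompactSupport g := hψ.hasCompactSupport_dbar_smul
  have hdχ := continuous_dbar hχ.contDiff
  have hdχi := hdχ.integrable_of_hasCompactSupport (μ := volume)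
    (hasCompactSupport_dbar hχ.hasCompactSupport)
  have hdψ := continuous_dbar hψ.contDiff
  have hmeas : ∀ w : ℂ, AEStronglyMeasurable (fun z : ℂ => (z - w)⁻¹) volume := fun w =>
    Measurable.aestronglyMeasurable (by fun_prop)
  -- the product of the integrands, split by the resolvent equation
  have hprod : ∀ w z, z ≠ w → f w * g z =
      ((z - w)⁻¹ • dbar ψ z) • f w - (dbar χ w * (z - w)⁻¹) • g z := by
    intro w z hzw
    have hne : z - w ≠ 0 := sub_ne_zero.mpr hzw
    by_cases hw : w ∈ spectrum ℂ a
    · have : dbar χ w = 0 := (hχ.dbar_eventually_eq hw).self_of_nhds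
      simp [hf, this]
    by_cases hz : z ∈ spectrum ℂ a
    · have : dbar ψ z = 0 := (hψ.dbar_eventually_eq hz).self_of_nhds
      simp [hg, this]
    simp only [hf, hg, smul_mul_smul_comm, resolvent_mul_resolvent hw hz hne]
    simp only [smul_sub, smul_smul, smul_eq_mul]
    congr 2 <;> ring
  have hi1 : ∀ w, Integrable fun z => (z - w)⁻¹ • dbar ψ z := fun w =>
    (integrable_norm_inv_sub_mul hdψ (hasCompactSupport_dbar hψ.hasCompactSupport) w).mono'
      ((hmeas w).smul hdψ.aestronglyMeasurable)
      (ae_of_all _ fun z => by rw [norm_smul, norm_inv])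
  have hi2 : ∀ w, Integrable fun z => (z - w)⁻¹ • g z := fun w =>
    (integrable_norm_inv_sub_mul hgc hgs w).mono' ((hmeas w).smul hgc.aestronglyMeasurable)
      (ae_of_all _ fun z => by rw [norm_smul, norm_inv])
  have hi3 : Integrable (fun p : ℂ × ℂ => (dbar χ p.1 * (p.2 - p.1)⁻¹) • g p.2)
      (volume.prod volume) := by
    refine (integrable_prod_norm_inv_sub (u := id) aemeasurable_id hdχi hgc hgs).mono' ?_
      (ae_of_all _ fun p => ?_)
    · have h1 : Measurable fun p : ℂ × ℂ => dbar χ p.1 * (p.2 - p.1)⁻¹ :=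
        (hdχ.measurable.comp measurable_fst).mul (measurable_snd.sub measurable_fst).inv
      exact h1.aestronglyMeasurable.smul hgc.aestronglyMeasurable.comp_snd
    · rw [norm_smul, norm_mul, norm_inv, mul_assoc, id]
  have hinner : ∀ w, ∫ z, f w * g z =
      (-(Real.pi : ℂ) * ψ w) • f w - ∫ z, (dbar χ w * (z - w)⁻¹) • g z := by
    intro w
    have h1 : (fun z => f w * g z) =ᵐ[volume] fun z =>
        ((z - w)⁻¹ • dbar ψ z) • f w - (dbar χ w * (z - w)⁻¹) • g z := by
      filter_upwards [compl_mem_ae_iff.mpr (measure_singleton w)] with z hz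
      exact hprod w z hz
    rw [integral_congr_ae h1, integral_sub ((hi1 w).smul_const _) (by
      simpa only [mul_smul] using (hi2 w).fun_smul (dbar χ w)), integral_smul_const,
      integral_inv_sub_smul_dbar hψ.contDiff hψ.hasCompactSupport, smul_eq_mul]
  have hswap : ∫ w, ∫ z, (dbar χ w * (z - w)⁻¹) • g z = ∫ z, ((Real.pi : ℂ) * χ z) • g z := by
    rw [integral_integral_swap (f := fun w z => (dbar χ w * (z - w)⁻¹) • g z) hi3]
    congr 1
    ext z
    have h1 : ∀ w, dbar χ w * (z - w)⁻¹ = -((w - z)⁻¹ • dbar χ w) := fun w => by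
      rw [← neg_sub w z, inv_neg, smul_eq_mul]; ring
    rw [integral_smul_const]
    simp only [h1]
    rw [integral_neg, integral_inv_sub_smul_dbar hχ.contDiff hχ.hasCompactSupport, smul_eq_mul,
      neg_mul, neg_neg]
  have hχc := hχ.contDiff.continuous
  have hψc := hψ.contDiff.continuous
  have hψf : Integrable fun w => ψ w • f w :=
    Continuous.integrable_of_hasCompactSupport (hψc.smul hχ.continuous_dbar_smul)
      (HasCompactSupport.smul_left (f := ψ) (f' := f) hχ.hasCompactSupport_dbar_smul)
  have hχg : Integrable fun w => χ w • g w :=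
    Continuous.integrable_of_hasCompactSupport (hχc.smul hgc)
      (HasCompactSupport.smul_left (f := χ) (f' := g) hgs)
  have hmul : (∫ w, f w) * ∫ z, g z = ∫ w, ∫ z, f w * g z := by
    have h1 := ((ContinuousLinearMap.mul ℂ B).flip (∫ z, g z)).integral_comp_comm hfi
    simp only [ContinuousLinearMap.mul_apply', ContinuousLinearMap.flip_apply] at h1
    rw [← h1]
    congr 1
    ext w
    exact ((ContinuousLinearMap.mul ℂ B (f w)).integral_comp_comm hgi).symm
  have hdbar : ∀ w, dbar (fun w => χ w * ψ w) w • resolvent a w = ψ w • f w + χ w • g w := by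
    intro w
    have := dbar_smul (hχ.contDiff.differentiable one_ne_zero w)
      (hψ.contDiff.differentiable one_ne_zero w)
    simp only [smul_eq_mul] at this
    rw [this, hf, hg]
    simp only [smul_smul, ← add_smul]
    congr 1
    ring
  have hi4 : Integrable fun w => ∫ z, (dbar χ w * (z - w)⁻¹) • g z := hi3.integral_prod_left
  have hfin : (∫ w, f w) * ∫ z, g z = (-(Real.pi : ℂ)) • ∫ w, (ψ w • f w + χ w • g w) := by
    rw [hmul]
    simp only [hinner]
    simp only [mul_smul (-(Real.pi : ℂ))]
    rw [integral_sub (hψf.fun_smul _) hi4]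
    rw [hswap]
    simp only [mul_smul (Real.pi : ℂ)]
    rw [integral_smul, integral_smul, integral_add hψf hχg, smul_add, neg_smul, neg_smul,
      sub_eq_add_neg]
  simp only [planarCalculus, hdbar]
  rw [smul_mul_smul_comm, hfin, smul_smul]
  congr 1
  field_simp

end Calculus

/-! ### Unit and contour integrals in the planar calculus -/

open scoped Manifold ContDiff in
/-- A compactly supported smooth Urysohn function, locally constant near both sets. -/
theorem exists_smooth_cutoff {s t : Set ℂ} (hs : IsClosed s) (ht : IsCompact t)
    (hd : Disjoint s t) : ∃ χ : ℂ → ℝ, ContDiff ℝ 1 χ ∧ HasCompactSupport χ ∧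
      (∀ z ∈ s, ∀ᶠ w in 𝓝 z, χ w = 0) ∧ ∀ z ∈ t, ∀ᶠ w in 𝓝 z, χ w = 1 := by
  obtain ⟨R, hR⟩ := ht.isBounded.subset_ball (0 : ℂ)
  obtain ⟨f, hf0, hf1, -⟩ := exists_contMDiffMap_zero_one_nhds_of_isClosed (n := 1) 𝓘(ℝ, ℂ)
    (hs.union (Metric.isOpen_ball (x := (0 : ℂ)) (ε := R)).isClosed_compl) ht.isClosed
    (hd.union_left (disjoint_compl_left_iff_subset.mpr hR))
  rw [eventually_nhdsSet_iff_forall] at hf0 hf1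
  refine ⟨f, f.contMDiff.contDiff, ?_, fun z hz => hf0 z (Or.inl hz), hf1⟩
  refine HasCompactSupport.intro (isCompact_closedBall (0 : ℂ) R) fun z hz => ?_
  exact (hf0 z (Or.inr fun h => hz (Metric.ball_subset_closedBall h))).self_of_nhds

theorem contDiff_ofReal {χ : ℂ → ℝ} (h : ContDiff ℝ 1 χ) : ContDiff ℝ 1 fun w => (χ w : ℂ) :=
  Complex.ofRealCLM.contDiff.comp h

theorem hasCompactSupport_ofReal {χ : ℂ → ℝ} (h : HasCompactSupport χ) :
    HasCompactSupport fun w => (χ w : ℂ) :=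
  h.comp_left (g := Complex.ofReal) Complex.ofReal_zero

section Calculus

variable {B : Type*} [NormedRing B] [NormedAlgebra ℂ B] [CompleteSpace B]

theorem planarCalculus_add {a : B} {χ ψ : ℂ → ℂ} (hχ : IsCutoff a χ) (hψ : IsCutoff a ψ) :
    planarCalculus a (fun w => χ w + ψ w) = planarCalculus a χ + planarCalculus a ψ := by
  have h : ∀ w, dbar (fun w => χ w + ψ w) w • resolvent a w
      = dbar χ w • resolvent a w + dbar ψ w • resolvent a w := fun w => by
    have h1 := dbar_sub (w := w) (hχ.contDiff.differentiable one_ne_zero w)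
      ((hψ.contDiff.neg).differentiable one_ne_zero w)
    have h2 : dbar (fun z => -ψ z) w = -dbar ψ w := by
      simp only [dbar, fderiv_fun_neg, _root_.neg_apply]
      module
    simp only [sub_neg_eq_add, h2] at h1
    rw [h1, add_smul]
  simp only [planarCalculus, h]
  rw [integral_add hχ.integrable hψ.integrable, smul_add]

open Bornology in
/-- Rescaling the cutoff leaves its calculus unchanged, and in the limit only the leading term
`1/w` of the resolvent at infinity survives. -/
theorem planarCalculus_eq_one {a : B} {χ : ℂ → ℂ} (hχ : IsCutoff a χ)
    (h1 : ∀ z ∈ spectrum ℂ a, ∀ᶠ w in 𝓝 z, χ w = 1) : planarCalculus a χ = 1 := by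
  have hπ : (Real.pi : ℂ) ≠ 0 := by exact_mod_cast Real.pi_ne_zero
  obtain ⟨χr, hr, hrs, -, hr1⟩ := exists_smooth_cutoff isClosed_empty
    (isCompact_closedBall (0 : ℂ) 1) (empty_disjoint _)
  set η : ℂ → ℂ := fun w => (χr w : ℂ) with hη
  have hηd : ContDiff ℝ 1 η := contDiff_ofReal hr
  have hηs : HasCompactSupport η := hasCompactSupport_ofReal hrs
  have hη1 : ∀ w ∈ Metric.closedBall (0 : ℂ) 1, ∀ᶠ z in 𝓝 w, η z = 1 := fun w hw => by
    filter_upwards [hr1 w hw] with z hz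
    simp [hη, hz]
  have hη0 : ∀ w, ‖w‖ ≤ 1 → dbar η w = 0 := fun w hw =>
    dbar_eq_zero_of_eventually_const (hη1 w (mem_closedBall_zero_iff.mpr hw))
  have hdi := (continuous_dbar hηd).integrable_of_hasCompactSupport (μ := volume)
    (hasCompactSupport_dbar hηs)
  have hR0 := spectrum.resolvent_tendsto_cobounded (𝕜 := ℂ) a
  obtain ⟨r, hr⟩ : ∃ r : ℝ, ∀ z : ℂ, r ≤ ‖z‖ → ‖resolvent a z‖ ≤ 1 := by
    have h2 : ∀ᶠ z in cobounded ℂ, ‖resolvent a z‖ ≤ 1 := by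
      filter_upwards [hR0.norm.eventually (gt_mem_nhds (by simp : ‖(0 : B)‖ < 1))] with z hz
      exact hz.le
    obtain ⟨r, -, hr⟩ := (hasBasis_cobounded_norm (E := ℂ)).eventually_iff.mp h2
    exact ⟨r, fun z hz => hr hz⟩
  -- the calculus of the rescaled cutoff
  have hscale : ∀ N : ℕ, ‖a‖ * ‖(1 : B)‖ < N →
      planarCalculus a χ =
        (-(Real.pi : ℂ)⁻¹) • ∫ u, dbar η u • ((N : ℂ) • resolvent a (N * u)) := by
    intro N hN
    have hN0 : (0 : ℝ) < N := lt_of_le_of_lt (by positivity) hN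
    have hN0' : (N : ℂ) ≠ 0 := by exact_mod_cast hN0.ne'
    have hcut1 : ∀ z ∈ spectrum ℂ a, ∀ᶠ w in 𝓝 z, η ((N : ℝ)⁻¹ • w) = 1 := by
      intro z hz
      have hz' := spectrum.norm_le_norm_mul_of_mem hz
      refine (hη1 ((N : ℝ)⁻¹ • z) ?_).filter_mono (continuous_const_smul (N : ℝ)⁻¹).continuousAt
      rw [mem_closedBall_zero_iff, norm_smul, norm_inv, Real.norm_of_nonneg hN0.le,
        inv_mul_le_one₀ hN0]
      exact hz'.trans hN.le
    have hcut : IsCutoff a fun w => η ((N : ℝ)⁻¹ • w) :=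
      ⟨hηd.comp (contDiff_const_smul _), hηs.comp_smul (inv_ne_zero hN0.ne'), fun z hz => by
        have := hcut1 z hz
        rw [this.self_of_nhds]
        exact this⟩
    rw [planarCalculus_congr hχ hcut fun z hz => by
      filter_upwards [h1 z hz, hcut1 z hz] with w h2 h3
      rw [h2, h3]]
    simp only [planarCalculus, dbar_comp_smul η _ _ (hηd.differentiable one_ne_zero)]
    congr 1
    have h2 := Measure.integral_comp_smul volume
      (fun w => (((N : ℝ)⁻¹ : ℝ) : ℂ) • dbar η ((N : ℝ)⁻¹ • w) • resolvent a w) (N : ℝ)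
    rw [Complex.finrank_real_complex, eq_comm, abs_of_pos (by positivity),
      inv_smul_eq_iff₀ (by positivity)] at h2
    simp only [smul_eq_mul, mul_smul]
    rw [h2, ← Complex.coe_smul, ← integral_smul]
    congr 1
    ext u
    simp only [smul_smul, Complex.real_smul]
    push_cast
    congr 1
    field_simp
  have hone : (-(Real.pi : ℂ)⁻¹) • ∫ u, dbar η u • (u⁻¹ • (1 : B)) = 1 := by
    have h2 := integral_inv_smul_dbar_zero hηd hηs
    have h3 : ∀ u, dbar η u • (u⁻¹ • (1 : B)) = (u⁻¹ • dbar η u) • (1 : B) := fun u => by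
      rw [smul_smul, smul_eq_mul, mul_comm]
    simp only [h3]
    rw [integral_smul_const, h2, (hη1 0 (by simp)).self_of_nhds, smul_smul]
    rw [smul_eq_mul, mul_one, neg_mul_neg, inv_mul_cancel₀ hπ, one_smul]
  -- convergence of the rescaled integrals
  have hlim : Tendsto (fun N : ℕ => ∫ u, dbar η u • ((N : ℂ) • resolvent a (N * u))) atTop
      (𝓝 (∫ u, dbar η u • (u⁻¹ • (1 : B)))) := by
    have hkey : ∀ (N : ℕ) (u : ℂ), ‖a‖ * ‖(1 : B)‖ < N → 1 ≤ ‖u‖ →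
        (N : ℂ) • resolvent a (N * u) = u⁻¹ • (1 : B) + u⁻¹ • (a * resolvent a (N * u)) := by
      intro N u hN hu
      have hu0 : u ≠ 0 := norm_pos_iff.mp (by linarith)
      have hmem : (N * u : ℂ) ∈ resolventSet ℂ a := by
        refine spectrum.mem_resolventSet_of_norm_lt_mul (hN.trans_le ?_)
        rw [norm_mul, Complex.norm_natCast]
        exact le_mul_of_one_le_right (Nat.cast_nonneg N) hu
      have h2 : (algebraMap ℂ B (N * u) - a) * resolvent a (N * u) = 1 :=
        Ring.mul_inverse_cancel _ hmem
      rw [← smul_add, eq_inv_smul_iff₀ hu0, smul_smul, mul_comm u]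
      rw [sub_mul, sub_eq_iff_eq_add, ← Algebra.smul_def] at h2
      exact h2
    refine tendsto_integral_filter_of_dominated_convergence
      (fun u => ‖dbar η u‖ * (‖(1 : B)‖ + ‖a‖)) ?_ ?_ (hdi.norm.mul_const _) ?_
    · filter_upwards [eventually_gt_atTop ⌈‖a‖ * ‖(1 : B)‖⌉₊] with N hN
      have hN' : ‖a‖ * ‖(1 : B)‖ < N := (Nat.le_ceil _).trans_lt (by exact_mod_cast hN)
      have hN0 : (0 : ℝ) < N := lt_of_le_of_lt (by positivity) hN'
      have hc : ContinuousOn (fun u : ℂ => dbar η u • ((N : ℂ) • resolvent a (N * u)))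
          {u | 1 ≤ ‖u‖} := by
        intro u hu
        have hmem : (N * u : ℂ) ∈ resolventSet ℂ a := by
          refine spectrum.mem_resolventSet_of_norm_lt_mul (hN'.trans_le ?_)
          rw [norm_mul, Complex.norm_natCast]
          exact le_mul_of_one_le_right (Nat.cast_nonneg N) hu
        have h3 : ContinuousAt (fun u : ℂ => resolvent a (N * u)) u :=
          ContinuousAt.comp (f := fun u : ℂ => (N : ℂ) * u) (g := resolvent a)
            (differentiableAt_resolvent (not_not.mpr hmem)).continuousAt (by fun_prop)
        exact ((continuous_dbar hηd).continuousAt.smul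
          (continuousAt_const.smul h3)).continuousWithinAt
      have hcl : IsClosed {u : ℂ | 1 ≤ ‖u‖} := isClosed_le continuous_const continuous_norm
      have hm := hc.aestronglyMeasurable (μ := volume) hcl.measurableSet
      rw [← aestronglyMeasurable_indicator_iff hcl.measurableSet] at hm
      refine hm.congr (ae_of_all _ fun u => ?_)
      by_cases hu : 1 ≤ ‖u‖
      · exact indicator_of_mem (show u ∈ {u : ℂ | 1 ≤ ‖u‖} from hu) _
      · rw [indicator_of_notMem (show u ∉ {u : ℂ | 1 ≤ ‖u‖} from hu)]
        simp [hη0 u (not_le.mp hu).le]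
    · filter_upwards [eventually_gt_atTop ⌈‖a‖ * ‖(1 : B)‖⌉₊, eventually_gt_atTop ⌈r⌉₊]
        with N hN hNr
      have hN' : ‖a‖ * ‖(1 : B)‖ < N := (Nat.le_ceil _).trans_lt (by exact_mod_cast hN)
      have hNr' : r < N := (Nat.le_ceil _).trans_lt (by exact_mod_cast hNr)
      refine ae_of_all _ fun u => ?_
      by_cases hu : 1 ≤ ‖u‖
      · rw [norm_smul, hkey N u hN' hu]
        refine mul_le_mul_of_nonneg_left ?_ (norm_nonneg _)
        have h3 : ‖u⁻¹‖ ≤ 1 := by rw [norm_inv]; exact inv_le_one_of_one_le₀ hu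
        have h4 : ‖resolvent a (N * u)‖ ≤ 1 := hr _ (by
          rw [norm_mul, Complex.norm_natCast]
          exact hNr'.le.trans (le_mul_of_one_le_right (Nat.cast_nonneg N) hu))
        rw [← smul_add, norm_smul]
        refine (mul_le_of_le_one_left (norm_nonneg _) h3).trans ((norm_add_le _ _).trans ?_)
        gcongr
        exact (norm_mul_le _ _).trans (mul_le_of_le_one_right (norm_nonneg _) h4)
      · rw [hη0 u (not_le.mp hu).le]
        simp
    · refine ae_of_all _ fun u => ?_
      by_cases hu : 1 ≤ ‖u‖
      · have hu0 : u ≠ 0 := norm_pos_iff.mp (by linarith)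
        have h3 : Tendsto (fun N : ℕ => (N : ℂ) * u) atTop (cobounded ℂ) := by
          rw [← tendsto_norm_atTop_iff_cobounded]
          simp only [norm_mul, Complex.norm_natCast]
          exact tendsto_natCast_atTop_atTop.atTop_mul_const (by linarith)
        have h4 : Tendsto (fun N : ℕ => dbar η u • (u⁻¹ • (1 : B) +
            u⁻¹ • (a * resolvent a (N * u)))) atTop (𝓝 (dbar η u • (u⁻¹ • (1 : B) +
            u⁻¹ • (a * 0)))) :=
          (((hR0.comp h3).const_mul a).const_smul u⁻¹ |>.const_add _).const_smul _
        rw [mul_zero, smul_zero, add_zero] at h4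
        refine h4.congr' ?_
        filter_upwards [eventually_gt_atTop ⌈‖a‖ * ‖(1 : B)‖⌉₊] with N hN
        rw [hkey N u ((Nat.le_ceil _).trans_lt (by exact_mod_cast hN)) hu]
      · simp [hη0 u (not_le.mp hu).le]
  rw [← hone]
  refine tendsto_nhds_unique (tendsto_const_nhds (f := (atTop : Filter ℕ))) ?_
  refine (hlim.const_smul (-(Real.pi : ℂ)⁻¹)).congr' ?_
  filter_upwards [eventually_gt_atTop ⌈‖a‖ * ‖(1 : B)‖⌉₊] with N hN
  exact (hscale N ((Nat.le_ceil _).trans_lt (by exact_mod_cast hN))).symm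

/-- The contour integral of the resolvent along the oriented boundary of `D` is the calculus of
any cutoff which is `1` near the spectrum in `D` and `0` near the rest of the spectrum. -/
theorem contourIntegral_resolvent {a : B} {D : Set ℂ} {n : ℕ} {γ : Fin n → ℝ → ℂ}
    (h : IsOrientedBoundary D γ) (hD : IsOpen D) (hb : Bornology.IsBounded D)
    (hfr : ∀ z ∈ frontier D, z ∉ spectrum ℂ a) {χ : ℂ → ℂ} (hχ : IsCutoff a χ)
    (h1 : ∀ z ∈ spectrum ℂ a, z ∈ D → ∀ᶠ w in 𝓝 z, χ w = 1)
    (h0 : ∀ z ∈ spectrum ℂ a, z ∉ D → ∀ᶠ w in 𝓝 z, χ w = 0) :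
    ∑ k, ∫ t in (0 : ℝ)..1, deriv (γ k) t • resolvent a (γ k t) =
      (2 * Real.pi * Complex.I) • planarCalculus a χ := by
  have hπ : (Real.pi : ℂ) ≠ 0 := by exact_mod_cast Real.pi_ne_zero
  have hsp : IsCompact (spectrum ℂ a) := spectrum.isCompact a
  have hcl : ∀ z ∈ spectrum ℂ a, z ∈ closure D → z ∈ D := fun z hz hzc => by
    by_contra hzD
    exact hfr z ⟨hzc, fun hh => hzD (interior_subset hh)⟩ hz
  have hS1 : IsCompact (spectrum ℂ a ∩ D) := by
    have : spectrum ℂ a ∩ D = spectrum ℂ a ∩ closure D :=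
      Subset.antisymm (inter_subset_inter_right _ subset_closure)
        fun z hz => ⟨hz.1, hcl z hz.1 hz.2⟩
    rw [this]
    exact hsp.inter_right isClosed_closure
  obtain ⟨ξr, hξ, hξs, hξ0, hξ1⟩ := exists_smooth_cutoff hD.isClosed_compl hS1
    (disjoint_compl_left_iff_subset.mpr inter_subset_right)
  obtain ⟨ψr, hψ, hψs, hψ0, hψ1⟩ := exists_smooth_cutoff
    (hsp.isClosed.inter hD.isClosed_compl) hb.isCompact_closure
    (disjoint_left.mpr fun z hz hzc => hz.2 (hcl z hz.1 hzc))
  set ξ : ℂ → ℂ := fun w => (ξr w : ℂ) with hξdef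
  set ψ : ℂ → ℂ := fun w => (ψr w : ℂ) with hψdef
  have hξd : ContDiff ℝ 1 ξ := contDiff_ofReal hξ
  have hψd : ContDiff ℝ 1 ψ := contDiff_ofReal hψ
  have hξ0' : ∀ z ∉ D, ∀ᶠ w in 𝓝 z, ξ w = 0 := fun z hz => by
    filter_upwards [hξ0 z hz] with w hw
    simp [hξdef, hw]
  have hξ1' : ∀ z ∈ spectrum ℂ a, z ∈ D → ∀ᶠ w in 𝓝 z, ξ w = 1 := fun z hz hzD => by
    filter_upwards [hξ1 z ⟨hz, hzD⟩] with w hw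
    simp [hξdef, hw]
  have hψ1' : ∀ z ∈ closure D, ∀ᶠ w in 𝓝 z, ψ w = 1 := fun z hz => by
    filter_upwards [hψ1 z hz] with w hw
    simp [hψdef, hw]
  have hξcut : IsCutoff a ξ := ⟨hξd, hasCompactSupport_ofReal hξs, fun z hz => by
    by_cases hzD : z ∈ D
    · rw [(hξ1' z hz hzD).self_of_nhds]
      exact hξ1' z hz hzD
    · rw [(hξ0' z hzD).self_of_nhds]
      exact hξ0' z hzD⟩
  -- `ψ - ξ` is `1` on the contour and vanishes near the spectrum, so that Stokes' theorem applies
  -- to `(ψ - ξ) • resolvent a`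
  have hdiff : ∀ z ∈ spectrum ℂ a, ∀ᶠ w in 𝓝 z, ψ w - ξ w = 0 := fun z hz => by
    by_cases hzD : z ∈ D
    · filter_upwards [hψ1' z (subset_closure hzD), hξ1' z hz hzD] with w hw hw'
      rw [hw, hw', sub_self]
    · filter_upwards [hψ0 z ⟨hz, hzD⟩, hξ0' z hzD] with w hw hw'
      simp [hψdef, hw, hw']
  have hdc := hψd.sub hξd
  have hst := h.sum_integral_eq hD (contDiff_smul_resolvent hdc hdiff)
    ((hasCompactSupport_ofReal hψs).sub (hasCompactSupport_ofReal hξs)).smul_right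
  have hleft : ∀ k, ∫ t in (0 : ℝ)..1, deriv (γ k) t • resolvent a (γ k t) =
      ∫ t in (0 : ℝ)..1, deriv (γ k) t • ((ψ (γ k t) - ξ (γ k t)) • resolvent a (γ k t)) := by
    intro k
    refine intervalIntegral.integral_congr fun t ht => ?_
    rw [uIcc_of_le zero_le_one] at ht
    have hmem : γ k t ∈ frontier D := by
      rw [← h.image_eq]
      exact mem_iUnion.mpr ⟨k, t, ht, rfl⟩
    have hnD : γ k t ∉ D := fun hh => hmem.2 (by rwa [hD.interior_eq])
    rw [(hψ1' _ hmem.1).self_of_nhds, (hξ0' _ hnD).self_of_nhds, sub_zero, one_smul]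
  have hright : ∫ w in D, dbar (fun w => (ψ w - ξ w) • resolvent a w) w =
      -∫ w, dbar ξ w • resolvent a w := by
    have h2 : ∀ w ∈ D, dbar (fun w => (ψ w - ξ w) • resolvent a w) w
        = -(dbar ξ w • resolvent a w) := by
      intro w hw
      rw [dbar_smul_resolvent hdc hdiff, dbar_sub (hψd.differentiable one_ne_zero w)
        (hξd.differentiable one_ne_zero w),
        dbar_eq_zero_of_eventually_const (hψ1' w (subset_closure hw)), zero_sub, neg_smul]
    rw [setIntegral_congr_fun hD.measurableSet h2, integral_neg,
      setIntegral_eq_integral_of_forall_compl_eq_zero fun w hw => ?_]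
    rw [dbar_eq_zero_of_eventually_const (hξ0' w hw), zero_smul]
  simp only [hleft]
  rw [hst, hright, planarCalculus_congr hχ hξcut fun z hz => ?_, planarCalculus, smul_smul,
    smul_neg, ← neg_smul]
  · congr 1
    field_simp
  · by_cases hzD : z ∈ D
    · filter_upwards [h1 z hz hzD, hξ1' z hz hzD] with w hw hw'
      rw [hw, hw']
    · filter_upwards [h0 z hz hzD, hξ0' z hzD] with w hw hw'
      rw [hw, hw']

end Calculus

/-! ### Grid squares and oriented boundaries -/

section Grid

/-- The closed unit square with lower left corner `c`. -/
def cell (c : ℤ × ℤ) : Set ℂ := Icc (c.1 : ℝ) (c.1 + 1) ×ℂ Icc (c.2 : ℝ) (c.2 + 1)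

/-- The interior of `cell c`. -/
def openCell (c : ℤ × ℤ) : Set ℂ := Ioo (c.1 : ℝ) (c.1 + 1) ×ℂ Ioo (c.2 : ℝ) (c.2 + 1)

/-- The half-open unit squares, which partition the plane. -/
def halfCell (c : ℤ × ℤ) : Set ℂ := Ioc (c.1 : ℝ) (c.1 + 1) ×ℂ Ioc (c.2 : ℝ) (c.2 + 1)

/-- The union of the closed cells in `S`. -/
def region (S : Finset (ℤ × ℤ)) : Set ℂ := ⋃ c ∈ S, cell c

/-- Starting points of the four sides of `cell 0`, in counterclockwise order. -/
def sideStart : Fin 4 → ℂ := ![0, 1, 1 + Complex.I, Complex.I]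

/-- Directions of the four sides of a cell, in counterclockwise order. -/
def sideDir : Fin 4 → ℂ := ![1, Complex.I, -1, -Complex.I]

/-- Offset of the cell across each side. -/
def sideNbr : Fin 4 → ℤ × ℤ := ![(0, -1), (1, 0), (0, 1), (-1, 0)]

/-- The side `d` of `cell c`, run through counterclockwise as `t` goes from `0` to `1`. -/
def side (c : ℤ × ℤ) (d : Fin 4) (t : ℝ) : ℂ :=
  (c.1 + c.2 * Complex.I) + sideStart d + t * sideDir d

/-- The sides that separate a cell in `S` from a cell not in `S`. -/
def boundarySides (S : Finset (ℤ × ℤ)) : Finset ((ℤ × ℤ) × Fin 4) :=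
  (S ×ˢ Finset.univ).filter fun x => x.1 + sideNbr x.2 ∉ S

theorem mem_boundarySides {S : Finset (ℤ × ℤ)} {x : (ℤ × ℤ) × Fin 4} :
    x ∈ boundarySides S ↔ x.1 ∈ S ∧ x.1 + sideNbr x.2 ∉ S := by
  simp [boundarySides]

theorem mem_cell {c : ℤ × ℤ} {z : ℂ} : z ∈ cell c ↔
    (c.1 ≤ z.re ∧ z.re ≤ c.1 + 1) ∧ (c.2 ≤ z.im ∧ z.im ≤ c.2 + 1) := Iff.rfl

theorem mem_halfCell {c : ℤ × ℤ} {z : ℂ} : z ∈ halfCell c ↔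
    (c.1 < z.re ∧ z.re ≤ c.1 + 1) ∧ (c.2 < z.im ∧ z.im ≤ c.2 + 1) := Iff.rfl

theorem mem_region {S : Finset (ℤ × ℤ)} {z : ℂ} : z ∈ region S ↔ ∃ c ∈ S, z ∈ cell c := by
  simp [region]

theorem isClosed_cell (c : ℤ × ℤ) : IsClosed (cell c) := isClosed_Icc.reProdIm isClosed_Icc

theorem isOpen_openCell (c : ℤ × ℤ) : IsOpen (openCell c) := isOpen_Ioo.reProdIm isOpen_Ioo

theorem isClosed_region (S : Finset (ℤ × ℤ)) : IsClosed (region S) :=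
  isClosed_biUnion_finset fun c _ => isClosed_cell c

theorem cell_subset_closure_openCell (c : ℤ × ℤ) : cell c ⊆ closure (openCell c) := by
  rw [openCell, Complex.closure_reProdIm, closure_Ioo (by linarith), closure_Ioo (by linarith)]
  rfl

theorem openCell_subset_cell (c : ℤ × ℤ) : openCell c ⊆ cell c := fun _ h =>
  ⟨⟨h.1.1.le, h.1.2.le⟩, ⟨h.2.1.le, h.2.2.le⟩⟩

theorem halfCell_subset_cell (c : ℤ × ℤ) : halfCell c ⊆ cell c := fun _ h =>
  ⟨⟨h.1.1.le, h.1.2⟩, ⟨h.2.1.le, h.2.2⟩⟩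

theorem eq_of_mem_openCell_of_mem_cell {c c' : ℤ × ℤ} {z : ℂ} (h : z ∈ openCell c)
    (h' : z ∈ cell c') : c' = c := by
  obtain ⟨⟨a1, a2⟩, a3, a4⟩ := h
  obtain ⟨⟨b1, b2⟩, b3, b4⟩ := h'
  have e1 : (c'.1 : ℝ) < c.1 + 1 := by linarith
  have e2 : (c.1 : ℝ) < c'.1 + 1 := by linarith
  have e3 : (c'.2 : ℝ) < c.2 + 1 := by linarith
  have e4 : (c.2 : ℝ) < c'.2 + 1 := by linarith
  norm_cast at e1 e2 e3 e4
  ext <;> omega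

theorem eq_of_mem_halfCell {c c' : ℤ × ℤ} {z : ℂ} (h : z ∈ halfCell c)
    (h' : z ∈ halfCell c') : c = c' := by
  obtain ⟨⟨a1, a2⟩, a3, a4⟩ := h
  obtain ⟨⟨b1, b2⟩, b3, b4⟩ := h'
  have e1 : (c'.1 : ℝ) < c.1 + 1 := by linarith
  have e2 : (c.1 : ℝ) < c'.1 + 1 := by linarith
  have e3 : (c'.2 : ℝ) < c.2 + 1 := by linarith
  have e4 : (c.2 : ℝ) < c'.2 + 1 := by linarith
  norm_cast at e1 e2 e3 e4
  ext <;> omega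

theorem cell_subset_closure_interior {S : Finset (ℤ × ℤ)} {c : ℤ × ℤ} (hc : c ∈ S) :
    cell c ⊆ closure (interior (region S)) :=
  (cell_subset_closure_openCell c).trans (closure_mono (interior_maximal
    (fun _ hz => mem_region.mpr ⟨c, hc, openCell_subset_cell c hz⟩) (isOpen_openCell c)))

/-- A cell that meets the interior of the region belongs to it. -/
theorem mem_of_mem_cell_of_mem_interior {S : Finset (ℤ × ℤ)} {c : ℤ × ℤ} {z : ℂ}
    (hz : z ∈ cell c) (hz' : z ∈ interior (region S)) : c ∈ S := by
  obtain ⟨w, hw, hw'⟩ := mem_closure_iff.mp (cell_subset_closure_openCell c hz) _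
    isOpen_interior hz'
  obtain ⟨c', hc', hwc'⟩ := mem_region.mp (interior_subset hw)
  rwa [← eq_of_mem_openCell_of_mem_cell hw' hwc']

/-- The unit intervals of the grid that contain points close to `x` also contain `x`. -/
theorem eventually_floor (x : ℝ) : ∀ᶠ y in 𝓝 x, (⌊y⌋ : ℝ) ≤ x ∧ x ≤ ⌊y⌋ + 1 := by
  filter_upwards [eventually_lt_nhds (Int.lt_floor_add_one x),
    eventually_gt_nhds (show (⌈x⌉ : ℝ) - 1 < x by linarith [Int.ceil_lt_add_one x])] with y h1 h2
  have h3 : ⌊y⌋ < ⌊x⌋ + 1 := Int.floor_lt.mpr (by exact_mod_cast h1)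
  have h4 : ⌈x⌉ - 1 ≤ ⌊y⌋ := Int.le_floor.mpr (by push_cast; exact h2.le)
  constructor
  · exact (Int.cast_le.mpr (by omega : ⌊y⌋ ≤ ⌊x⌋)).trans (Int.floor_le x)
  · refine (Int.le_ceil x).trans ?_
    exact_mod_cast (by omega : ⌈x⌉ ≤ ⌊y⌋ + 1)

/-- A point is interior to the region if all cells around it belong to the region. -/
theorem mem_interior_region {S : Finset (ℤ × ℤ)} {z : ℂ} (h : ∀ c, z ∈ cell c → c ∈ S) :
    z ∈ interior (region S) := by
  rw [mem_interior_iff_mem_nhds]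
  filter_upwards [Complex.continuous_re.continuousAt.eventually (eventually_floor z.re),
    Complex.continuous_im.continuousAt.eventually (eventually_floor z.im)] with w h1 h2
  exact mem_region.mpr ⟨(⌊w.re⌋, ⌊w.im⌋), h _ ⟨h1, h2⟩,
    ⟨Int.floor_le _, (Int.lt_floor_add_one _).le⟩, ⟨Int.floor_le _, (Int.lt_floor_add_one _).le⟩⟩

theorem side_mem_cell (c : ℤ × ℤ) (d : Fin 4) {t : ℝ} (ht : t ∈ Icc (0 : ℝ) 1) :
    side c d t ∈ cell c := by
  obtain ⟨h0, h1⟩ := ht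
  fin_cases d <;> simp [side, sideStart, sideDir, mem_cell] <;> (try constructor) <;> linarith

/-- The side `d` of a cell is the opposite side `d + 2` of its neighbour, run through backwards. -/
theorem side_reverse (c : ℤ × ℤ) (d : Fin 4) (t : ℝ) :
    side (c + sideNbr d) (d + 2) t = side c d (1 - t) := by
  fin_cases d <;> simp [side, sideStart, sideDir, sideNbr] <;> ring

theorem sideDir_reverse (d : Fin 4) : sideDir (d + 2) = -sideDir d := by
  fin_cases d <;> simp [sideDir]

theorem sideNbr_reverse (d : Fin 4) : sideNbr d + sideNbr (d + 2) = 0 := by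
  fin_cases d <;> simp [sideNbr]

/-- Two neighbouring cells only meet along their common side. -/
theorem exists_side_eq {c : ℤ × ℤ} {d : Fin 4} {z : ℂ} (h : z ∈ cell c)
    (h' : z ∈ cell (c + sideNbr d)) : ∃ t ∈ Icc (0 : ℝ) 1, side c d t = z := by
  obtain ⟨⟨a1, a2⟩, a3, a4⟩ := h
  obtain ⟨⟨b1, b2⟩, b3, b4⟩ := h'
  fin_cases d <;> simp [sideNbr] at b1 b2 b3 b4
  · refine ⟨z.re - c.1, ⟨by linarith, by linarith⟩, ?_⟩
    apply Complex.ext <;> simp [side, sideStart, sideDir]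
    all_goals linarith
  · refine ⟨z.im - c.2, ⟨by linarith, by linarith⟩, ?_⟩
    apply Complex.ext <;> simp [side, sideStart, sideDir]
    all_goals linarith
  · refine ⟨c.1 + 1 - z.re, ⟨by linarith, by linarith⟩, ?_⟩
    apply Complex.ext <;> simp [side, sideStart, sideDir]
    all_goals linarith
  · refine ⟨c.2 + 1 - z.im, ⟨by linarith, by linarith⟩, ?_⟩
    apply Complex.ext <;> simp [side, sideStart, sideDir]
    all_goals linarith

theorem side_mem_frontier {S : Finset (ℤ × ℤ)} {x : (ℤ × ℤ) × Fin 4} (hx : x ∈ boundarySides S)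
    {t : ℝ} (ht : t ∈ Icc (0 : ℝ) 1) : side x.1 x.2 t ∈ frontier (interior (region S)) := by
  obtain ⟨h1, h2⟩ := mem_boundarySides.mp hx
  refine ⟨cell_subset_closure_interior h1 (side_mem_cell _ _ ht), fun h => h2 ?_⟩
  rw [interior_interior] at h
  refine mem_of_mem_cell_of_mem_interior ?_ h
  have h3 := side_mem_cell (x.1 + sideNbr x.2) (x.2 + 2) (t := 1 - t)
    ⟨by linarith [ht.2], by linarith [ht.1]⟩
  rwa [side_reverse, sub_sub_cancel] at h3

theorem iUnion_side_image (S : Finset (ℤ × ℤ)) :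
    ⋃ x ∈ boundarySides S, side x.1 x.2 '' Icc 0 1 = frontier (interior (region S)) := by
  refine Subset.antisymm (iUnion₂_subset fun x hx => ?_) fun z hz => ?_
  · rintro _ ⟨t, ht, rfl⟩
    exact side_mem_frontier hx ht
  obtain ⟨hz1, hz2⟩ := hz
  rw [interior_interior] at hz2
  by_contra hcon
  simp only [mem_iUnion, mem_image, not_exists] at hcon
  -- without a boundary side through `z`, membership in `S` spreads to all cells around `z`
  have step : ∀ c ∈ S, ∀ d, z ∈ cell c → z ∈ cell (c + sideNbr d) → c + sideNbr d ∈ S := by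
    intro c hc d h1 h2
    by_contra h3
    obtain ⟨t, ht, hs⟩ := exists_side_eq h1 h2
    exact hcon (c, d) (mem_boundarySides.mpr ⟨hc, h3⟩) t ⟨ht, hs⟩
  have hz3 : z ∈ region S := closure_minimal interior_subset (isClosed_region S) hz1
  obtain ⟨c, hc, hzc⟩ := mem_region.mp hz3
  refine hz2 (mem_interior_region fun c' hzc' => ?_)
  have near : ∀ m m' : ℤ, ∀ x : ℝ, m ≤ x → x ≤ m + 1 → m' ≤ x → x ≤ m' + 1 →
      m' = m ∨ m' = m + 1 ∨ m' = m - 1 := by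
    intro m m' x g1 g2 g3 g4
    have e1 : (m' : ℝ) ≤ m + 1 := by linarith
    have e2 : (m : ℝ) ≤ m' + 1 := by linarith
    norm_cast at e1 e2
    omega
  have hmid : (c'.1, c.2) ∈ S := by
    have hz4 : z ∈ cell (c'.1, c.2) := ⟨hzc'.1, hzc.2⟩
    rcases near c.1 c'.1 z.re hzc.1.1 hzc.1.2 hzc'.1.1 hzc'.1.2 with h | h | h
    · rwa [h]
    · have e : c + sideNbr 1 = (c'.1, c.2) := by ext <;> simp [sideNbr, h]
      exact e ▸ step c hc 1 hzc (e ▸ hz4)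
    · have e : c + sideNbr 3 = (c'.1, c.2) := by ext <;> simp [sideNbr, h, sub_eq_add_neg]
      exact e ▸ step c hc 3 hzc (e ▸ hz4)
  have hz4 : z ∈ cell (c'.1, c.2) := ⟨hzc'.1, hzc.2⟩
  rcases near c.2 c'.2 z.im hzc.2.1 hzc.2.2 hzc'.2.1 hzc'.2.2 with h | h | h
  · have e : c' = (c'.1, c.2) := by ext <;> simp [h]
    rwa [e]
  · have e : (c'.1, c.2) + sideNbr 2 = c' := by ext <;> simp [sideNbr, h]
    exact e ▸ step _ hmid 2 hz4 (by rwa [e])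
  · have e : (c'.1, c.2) + sideNbr 0 = c' := by ext <;> simp [sideNbr, h, sub_eq_add_neg]
    exact e ▸ step _ hmid 0 hz4 (by rwa [e])

theorem interior_region_subset (S : Finset (ℤ × ℤ)) :
    interior (region S) ⊆ ⋃ c ∈ S, halfCell c := by
  intro z hz
  have h1 : z ∈ halfCell (⌈z.re⌉ - 1, ⌈z.im⌉ - 1) := by
    refine mem_halfCell.mpr ⟨⟨?_, ?_⟩, ?_, ?_⟩ <;> push_cast
    · linarith [Int.ceil_lt_add_one z.re]
    · linarith [Int.le_ceil z.re]
    · linarith [Int.ceil_lt_add_one z.im]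
    · linarith [Int.le_ceil z.im]
  exact mem_biUnion (mem_of_mem_cell_of_mem_interior (halfCell_subset_cell _ h1) hz) h1

/-- The integral of `g` along the side `d` of `cell c`. -/
def sideIntegral (g : ℂ → ℂ) (c : ℤ × ℤ) (d : Fin 4) : ℂ :=
  ∫ t in (0 : ℝ)..1, sideDir d * g (side c d t)

theorem sideIntegral_reverse (g : ℂ → ℂ) (c : ℤ × ℤ) (d : Fin 4) :
    sideIntegral g (c + sideNbr d) (d + 2) = -sideIntegral g c d := by
  have h := intervalIntegral.integral_comp_sub_left (a := 0) (b := 1)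
    (fun t => sideDir d * g (side c d t)) 1
  simp only [sub_self, sub_zero] at h
  simp only [sideIntegral, side_reverse, sideDir_reverse, neg_mul]
  rw [intervalIntegral.integral_neg, h]

/-- Sides shared by two cells of `S` are run through in both directions and cancel. -/
theorem sum_boundarySides (g : ℂ → ℂ) (S : Finset (ℤ × ℤ)) :
    ∑ x ∈ boundarySides S, sideIntegral g x.1 x.2 = ∑ c ∈ S, ∑ d, sideIntegral g c d := by
  rw [← Finset.sum_product', ← Finset.sum_filter_add_sum_filter_not (S ×ˢ Finset.univ)
    fun x : (ℤ × ℤ) × Fin 4 => x.1 + sideNbr x.2 ∉ S]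
  rw [boundarySides, left_eq_add]
  refine Finset.sum_involution (fun x _ => (x.1 + sideNbr x.2, x.2 + 2)) ?_ ?_ ?_ ?_
  · intro x _
    rw [sideIntegral_reverse, add_neg_cancel]
  -- no side is its own reverse
  · rintro ⟨c, d⟩ _ _ h
    have : d + 2 = d := congrArg Prod.snd h
    revert this
    fin_cases d <;> decide
  · intro x hx
    simp only [Finset.mem_filter, Finset.mem_product, Finset.mem_univ, and_true, not_not] at hx ⊢
    refine ⟨hx.2, ?_⟩
    rw [add_assoc, sideNbr_reverse, add_zero]
    exact hx.1
  · rintro ⟨c, d⟩ _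
    refine Prod.ext ?_ ?_
    · change c + sideNbr d + sideNbr (d + 2) = c
      rw [add_assoc, sideNbr_reverse, add_zero]
    · change d + 2 + 2 = d
      fin_cases d <;> rfl

theorem setIntegral_halfCell (f : ℂ → ℂ) (hf : Continuous f) (c : ℤ × ℤ) :
    ∫ w in halfCell c, f w =
      ∫ x in (c.1 : ℝ)..(c.1 + 1), ∫ y in (c.2 : ℝ)..(c.2 + 1), f (x + y * Complex.I) := by
  have h1 := Complex.volume_preserving_equiv_real_prod.setIntegral_preimage_emb
    Complex.measurableEquivRealProd.measurableEmbedding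
    (fun p : ℝ × ℝ => f (p.1 + p.2 * Complex.I))
    (Ioc (c.1 : ℝ) (c.1 + 1) ×ˢ Ioc (c.2 : ℝ) (c.2 + 1))
  have h2 : ∀ w : ℂ, f ((Complex.measurableEquivRealProd w).1 +
      (Complex.measurableEquivRealProd w).2 * Complex.I) = f w := fun w => by
    simp [Complex.measurableEquivRealProd_apply]
  simp only [h2] at h1
  have hi : IntegrableOn (fun p : ℝ × ℝ => f (p.1 + p.2 * Complex.I))
      (Ioc (c.1 : ℝ) (c.1 + 1) ×ˢ Ioc (c.2 : ℝ) (c.2 + 1)) (volume.prod volume) :=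
    (ContinuousOn.integrableOn_compact (isCompact_Icc.prod isCompact_Icc)
      (Continuous.continuousOn (by fun_prop))).mono_set
      (prod_mono Ioc_subset_Icc_self Ioc_subset_Icc_self)
  rw [Measure.volume_eq_prod, setIntegral_prod _ hi] at h1
  simp only [intervalIntegral.integral_of_le (show (c.1 : ℝ) ≤ c.1 + 1 by linarith),
    intervalIntegral.integral_of_le (show (c.2 : ℝ) ≤ c.2 + 1 by linarith)]
  exact h1

/-- Green's theorem on a cell. -/
theorem sum_sideIntegral_cell {g : ℂ → ℂ} (hg : ContDiff ℝ 1 g) (c : ℤ × ℤ) :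
    ∑ d, sideIntegral g c d = (2 * Complex.I) * ∫ w in halfCell c, dbar g w := by
  have hD := hg.continuous_fderiv one_ne_zero
  have h1 := Complex.integral_boundary_rect_of_differentiableOn_real g
    ⟨(c.1 : ℝ), (c.2 : ℝ)⟩ ⟨(c.1 : ℝ) + 1, (c.2 : ℝ) + 1⟩
    (hg.differentiable one_ne_zero).differentiableOn
    (ContinuousOn.integrableOn_compact (isCompact_uIcc.reProdIm isCompact_uIcc)
      (Continuous.continuousOn (by fun_prop)))
  have h2 : ∀ w, Complex.I • fderiv ℝ g w 1 - fderiv ℝ g w Complex.I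
      = (2 * Complex.I) * dbar g w := fun w => by
    simp only [dbar, smul_eq_mul]
    linear_combination (- fderiv ℝ g w Complex.I) * Complex.I_sq
  simp only [h2] at h1
  rw [setIntegral_halfCell _ (continuous_dbar hg), ← intervalIntegral.integral_const_mul]
  simp only [← intervalIntegral.integral_const_mul]
  simp only [smul_eq_mul, ← intervalIntegral.integral_const_mul] at h1
  rw [← h1, Fin.sum_univ_four]
  have shift : ∀ (f : ℝ → ℂ) (m : ℝ), ∫ x in m..(m + 1), f x = ∫ t in (0 : ℝ)..1, f (m + t) := by
    intro f m
    rw [intervalIntegral.integral_comp_add_left, add_zero]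
  have shift' : ∀ (f : ℝ → ℂ) (m : ℝ),
      ∫ x in m..(m + 1), f x = ∫ t in (0 : ℝ)..1, f (m + 1 - t) := by
    intro f m
    rw [intervalIntegral.integral_comp_sub_left, sub_zero, add_sub_cancel_right]
  rw [shift (fun x => g (x + _)), shift' (fun x => g (x + _)), shift (fun y => Complex.I * _),
    shift' (fun y => Complex.I * _)]
  -- bottom, top, right, left is reordered to bottom, right, top, left
  have e : ∀ a b p q : ℂ, a - b + p - q = a + p + (-b) + (-q) := fun a b p q => by ring
  rw [e, ← intervalIntegral.integral_neg, ← intervalIntegral.integral_neg]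
  simp only [sideIntegral]
  congr 1
  · congr 1
    · congr 1
      · congr 1; ext t; simp [sideDir, side, sideStart]; congr 1; ring
      · congr 1; ext t; simp [sideDir, side, sideStart]; congr 1; ring
    · congr 1; ext t; simp [sideDir, side, sideStart]; congr 1; ring
  · congr 1; ext t; simp [sideDir, side, sideStart]; congr 1; ring

theorem sum_boundarySides_eq_integral {g : ℂ → ℂ} (hg : ContDiff ℝ 1 g) (S : Finset (ℤ × ℤ)) :
    ∑ x ∈ boundarySides S, sideIntegral g x.1 x.2 =
      (2 * Complex.I) * ∫ w in ⋃ c ∈ S, halfCell c, dbar g w := by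
  rw [sum_boundarySides, Finset.sum_congr rfl fun c _ => sum_sideIntegral_cell hg c,
    ← Finset.mul_sum, integral_biUnion_finset]
  · exact fun c _ => (measurableSet_Ioc.preimage Complex.measurable_re).inter
      (measurableSet_Ioc.preimage Complex.measurable_im)
  · exact fun c _ c' _ hne => disjoint_left.mpr fun z h h' => hne (eq_of_mem_halfCell h h')
  · exact fun c _ => ((continuous_dbar hg).continuousOn.integrableOn_compact
      (isCompact_Icc.reProdIm isCompact_Icc)).mono_set (halfCell_subset_cell c)

/-- Green's theorem for a Cauchy kernel whose pole has been cut off. -/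
theorem sum_boundarySides_inv_sub (S : Finset (ℤ × ℤ)) {w : ℂ} {χ : ℂ → ℝ}
    (hχ : ContDiff ℝ 1 χ) (h1 : ∀ᶠ z in 𝓝 w, χ z = 1)
    (h0 : ∀ z ∈ frontier (interior (region S)), χ z = 0) :
    ∑ x ∈ boundarySides S, sideIntegral (fun z => (z - w)⁻¹) x.1 x.2 = -(2 * Complex.I) *
      ∫ z in ⋃ c ∈ S, halfCell c, (z - w)⁻¹ • dbar (fun z => (χ z : ℂ)) z := by
  set g : ℂ → ℂ := fun z => (1 - (χ z : ℂ)) • (z - w)⁻¹ with hg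
  have hχc : ContDiff ℝ 1 fun z => 1 - (χ z : ℂ) := contDiff_const.sub (contDiff_ofReal hχ)
  have hgw : ∀ᶠ z in 𝓝 w, g z = 0 := by
    filter_upwards [h1] with z hz
    simp [hg, hz]
  have hinv : ∀ z, z ≠ w → DifferentiableAt ℂ (fun z => (z - w)⁻¹) z := fun z hz =>
    (differentiableAt_id.sub_const w).inv (sub_ne_zero.mpr hz)
  have hgd : ContDiff ℝ 1 g := by
    rw [contDiff_iff_contDiffAt]
    intro z
    by_cases hz : z = w
    · subst hz
      exact (contDiffAt_const (c := (0 : ℂ))).congr_of_eventuallyEq hgw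
    · refine hχc.contDiffAt.smul ?_
      exact (contDiffAt_id.sub contDiffAt_const).inv (sub_ne_zero.mpr hz)
  have hdbar : ∀ z, dbar g z = -((z - w)⁻¹ • dbar (fun z => (χ z : ℂ)) z) := by
    intro z
    by_cases hz : z = w
    · subst hz
      rw [dbar_eq_zero_of_eventually_const hgw, sub_self, inv_zero, zero_smul, neg_zero]
    · rw [hg, dbar_smul (hχc.differentiable one_ne_zero z) ((hinv z hz).restrictScalars ℝ),
        dbar_eq_zero_of_differentiableAt (hinv z hz), dbar_sub (differentiableAt_const 1)
        ((contDiff_ofReal hχ).differentiable one_ne_zero z),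
        dbar_eq_zero_of_eventually_const (f := fun _ => (1 : ℂ)) (c := 1) (by simp)]
      simp only [smul_eq_mul]
      ring
  have hside : ∀ x ∈ boundarySides S, sideIntegral (fun z => (z - w)⁻¹) x.1 x.2 =
      sideIntegral g x.1 x.2 := by
    intro x hx
    refine intervalIntegral.integral_congr fun t ht => ?_
    rw [uIcc_of_le zero_le_one] at ht
    simp [hg, h0 _ (side_mem_frontier hx ht)]
  rw [Finset.sum_congr rfl hside, sum_boundarySides_eq_integral hgd]
  simp only [hdbar]
  rw [integral_neg, mul_neg, neg_mul]

theorem sum_boundarySides_index_inside (S : Finset (ℤ × ℤ)) {w : ℂ}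
    (hw : w ∈ interior (region S)) :
    ∑ x ∈ boundarySides S, sideIntegral (fun z => (z - w)⁻¹) x.1 x.2 =
      2 * Real.pi * Complex.I := by
  obtain ⟨χ, hχ, hχs, hχ0, hχ1⟩ := exists_smooth_cutoff
    (isOpen_interior (s := region S)).isClosed_compl (isCompact_singleton (x := w))
    (disjoint_singleton_right.mpr (not_not.mpr hw))
  have h0 : ∀ z, z ∉ interior (region S) → dbar (fun z => (χ z : ℂ)) z = 0 := fun z hz =>
    dbar_eq_zero_of_eventually_const (c := 0) (by
      filter_upwards [hχ0 z hz] with u hu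
      simp [hu])
  rw [sum_boundarySides_inv_sub S hχ (hχ1 w rfl) fun z hz =>
    (hχ0 z fun hh => hz.2 (by rwa [interior_interior])).self_of_nhds,
    setIntegral_eq_integral_of_forall_compl_eq_zero fun z hz => by
      rw [h0 z fun hh => hz (interior_region_subset S hh), smul_zero],
    integral_inv_sub_smul_dbar (contDiff_ofReal hχ) (hasCompactSupport_ofReal hχs),
    (hχ1 w rfl).self_of_nhds]
  simp only [Complex.ofReal_one, smul_eq_mul]
  ring

theorem sum_boundarySides_index_outside (S : Finset (ℤ × ℤ)) {w : ℂ}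
    (hw : w ∉ closure (interior (region S))) :
    ∑ x ∈ boundarySides S, sideIntegral (fun z => (z - w)⁻¹) x.1 x.2 = 0 := by
  obtain ⟨χ, hχ, hχs, hχ0, hχ1⟩ := exists_smooth_cutoff
    (isClosed_closure (s := interior (region S))) (isCompact_singleton (x := w))
    (disjoint_singleton_right.mpr hw)
  rw [sum_boundarySides_inv_sub S hχ (hχ1 w rfl) fun z hz => (hχ0 z hz.1).self_of_nhds,
    setIntegral_eq_zero_of_forall_eq_zero fun z hz => ?_, mul_zero]
  obtain ⟨c, hc, hzc⟩ := mem_iUnion₂.mp hz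
  rw [dbar_eq_zero_of_eventually_const (c := 0), smul_zero]
  filter_upwards [hχ0 z (cell_subset_closure_interior hc (halfCell_subset_cell c hzc))] with u hu
  simp [hu]

theorem hasDerivAt_side (c : ℤ × ℤ) (d : Fin 4) (t : ℝ) :
    HasDerivAt (side c d) (sideDir d) t := by
  have h : HasDerivAt (fun t : ℝ => (t : ℂ) * sideDir d) (sideDir d) t := by
    simpa using (hasDerivAt_id t).ofReal_comp.mul_const (sideDir d)
  exact h.const_add _

theorem isOrientedBoundary_region (S : Finset (ℤ × ℤ)) :
    ∃ (n : ℕ) (γ : Fin n → ℝ → ℂ), IsOrientedBoundary (interior (region S)) γ := by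
  set e := (boundarySides S).equivFin with he
  have hsum : ∀ w, ∑ k, ∫ t in (0 : ℝ)..1, deriv (side (e.symm k).1.1 (e.symm k).1.2) t /
      (side (e.symm k).1.1 (e.symm k).1.2 t - w) =
      ∑ x ∈ boundarySides S, sideIntegral (fun z => (z - w)⁻¹) x.1 x.2 := by
    intro w
    simp only [(hasDerivAt_side _ _ _).deriv, div_eq_mul_inv]
    rw [← Finset.sum_coe_sort (boundarySides S)]
    exact Equiv.sum_comp e.symm
      fun x => sideIntegral (fun z => (z - w)⁻¹) (x : (ℤ × ℤ) × Fin 4).1 x.1.2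
  refine ⟨_, fun k => side (e.symm k).1.1 (e.symm k).1.2, ⟨fun k => ?_, ?_, fun w hw => ?_,
    fun w hw => ?_⟩⟩
  · have : ContDiff ℝ 1 (side (e.symm k).1.1 (e.symm k).1.2) :=
      contDiff_const.add (Complex.ofRealCLM.contDiff.mul contDiff_const)
    exact this.contDiffOn
  · rw [← iUnion_side_image]
    refine Eq.trans ?_ (iUnion_subtype (fun x => x ∈ boundarySides S)
      fun x => side x.1.1 x.1.2 '' Icc 0 1)
    exact e.symm.surjective.iUnion_comp
      fun x : {x // x ∈ boundarySides S} => side x.1.1 x.1.2 '' Icc 0 1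
  · rw [hsum, sum_boundarySides_index_inside S hw]
  · rw [hsum, sum_boundarySides_index_outside S hw]

theorem isOrientedBoundary_smul {D : Set ℂ} {n : ℕ} {γ : Fin n → ℝ → ℂ}
    (h : IsOrientedBoundary D γ) {r : ℝ} (hr : 0 < r) :
    IsOrientedBoundary ((fun z : ℂ => r * z) '' D) fun k t => r * γ k t := by
  have hr' : (r : ℂ) ≠ 0 := by exact_mod_cast hr.ne'
  set f : ℂ ≃ₜ ℂ := Homeomorph.mulLeft₀ (r : ℂ) hr' with hf
  have hfr : (fun z : ℂ => r * z) = f := rfl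
  have hint : ∀ u : ℂ, ∑ k, ∫ t in (0 : ℝ)..1,
      deriv (fun t => (r : ℂ) * γ k t) t / (r * γ k t - r * u) =
      ∑ k, ∫ t in (0 : ℝ)..1, deriv (γ k) t / (γ k t - u) := by
    intro u
    congr! 3 with k _ t
    rw [deriv_const_mul_field, ← mul_sub, mul_div_mul_left _ _ hr']
  refine ⟨fun k => contDiffOn_const.mul (h.contDiffOn k), ?_, ?_, ?_⟩
  · rw [hfr, ← f.image_frontier, ← h.image_eq, image_iUnion]
    simp only [image_image]
    rfl
  · rintro _ ⟨u, hu, rfl⟩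
    rw [hint, h.index_inside u hu]
  · intro w hw
    have hw' : w = r * ((r : ℂ)⁻¹ * w) := by field_simp
    rw [hw', hint, h.index_outside]
    intro hu
    apply hw
    rw [hfr, ← f.image_closure]
    exact ⟨_, hu, hw'.symm⟩

/-- The interior of the union of all grid cells that meet `σ`. -/
theorem exists_orientedBoundary_unit {σ : Set ℂ} (hσ : Bornology.IsBounded σ)
    (hc : ∀ z ∈ σ, (starRingEnd ℂ) z ∈ σ) :
    ∃ (D : Set ℂ) (n : ℕ) (γ : Fin n → ℝ → ℂ), IsOpen D ∧ σ ⊆ D ∧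
      (∀ z ∈ D, (starRingEnd ℂ) z ∈ D) ∧ (∀ z ∈ closure D, ∃ s ∈ σ, dist z s ≤ 2) ∧
      IsOrientedBoundary D γ := by
  obtain ⟨R, hR⟩ := hσ.subset_closedBall 0
  obtain ⟨N, hN⟩ := exists_nat_gt (R + 1)
  have hfin : {c : ℤ × ℤ | (cell c ∩ σ).Nonempty}.Finite := by
    refine (Finset.Icc (-(N : ℤ)) N ×ˢ Finset.Icc (-(N : ℤ)) N).finite_toSet.subset ?_
    rintro c ⟨s, ⟨⟨a1, a2⟩, a3, a4⟩, hs⟩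
    have hs' := mem_closedBall_zero_iff.mp (hR hs)
    have b1 := abs_le.mp ((Complex.abs_re_le_norm s).trans hs')
    have b2 := abs_le.mp ((Complex.abs_im_le_norm s).trans hs')
    have e1 : (-(N : ℤ) : ℝ) ≤ c.1 := by push_cast; linarith
    have e2 : (c.1 : ℝ) ≤ N := by linarith
    have e3 : (-(N : ℤ) : ℝ) ≤ c.2 := by push_cast; linarith
    have e4 : (c.2 : ℝ) ≤ N := by linarith
    norm_cast at e1 e2 e3 e4
    simp only [Finset.coe_product, Finset.coe_Icc, mem_prod, mem_Icc]
    exact ⟨⟨e1, e2⟩, e3, e4⟩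
  set S := hfin.toFinset with hS
  have hmem : ∀ c, c ∈ S ↔ (cell c ∩ σ).Nonempty := fun c => by simp [hS]
  have hcell : ∀ c z, z ∈ cell c → (starRingEnd ℂ) z ∈ cell (c.1, -c.2 - 1) := by
    rintro c z ⟨h1, h2, h3⟩
    refine ⟨by simpa using h1, ?_, ?_⟩ <;> simp <;> linarith
  have hreg : ∀ z ∈ region S, (starRingEnd ℂ) z ∈ region S := by
    intro z hz
    obtain ⟨c, hcS, hzc⟩ := mem_region.mp hz
    obtain ⟨s, hs, hsσ⟩ := (hmem c).mp hcS
    exact mem_region.mpr ⟨_, (hmem _).mpr ⟨_, hcell c s hs, hc s hsσ⟩, hcell c z hzc⟩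
  obtain ⟨n, γ, hγ⟩ := isOrientedBoundary_region S
  refine ⟨interior (region S), n, γ, isOpen_interior, fun s hs => ?_, fun z hz => ?_,
    fun z hz => ?_, hγ⟩
  · exact mem_interior_region fun c hsc => (hmem c).mpr ⟨s, hsc, hs⟩
  · have h1 : (starRingEnd ℂ) ⁻¹' interior (region S) ⊆ interior (region S) :=
      interior_maximal (fun u hu => by simpa using hreg _ (interior_subset hu))
        (isOpen_interior.preimage Complex.continuous_conj)
    exact h1 (by simpa using hz)
  · obtain ⟨c, hcS, ⟨h1, h2⟩, h3, h4⟩ :=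
      mem_region.mp (closure_minimal interior_subset (isClosed_region S) hz)
    obtain ⟨s, ⟨⟨h5, h6⟩, h7, h8⟩, hsσ⟩ := (hmem c).mp hcS
    refine ⟨s, hsσ, ?_⟩
    rw [dist_eq_norm]
    refine (Complex.norm_le_abs_re_add_abs_im _).trans ?_
    have g1 : |(z - s).re| ≤ 1 := abs_le.mpr ⟨by simp; linarith, by simp; linarith⟩
    have g2 : |(z - s).im| ≤ 1 := abs_le.mpr ⟨by simp; linarith, by simp; linarith⟩
    linarith

/-- Every compact set which is symmetric about the real axis has arbitrarily close symmetric
neighbourhoods with a piecewise `C¹` oriented boundary. -/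
theorem exists_orientedBoundary {σ L : Set ℂ} (hσ : IsCompact σ) (hL : IsClosed L)
    (hd : Disjoint σ L) (hc : ∀ z ∈ σ, (starRingEnd ℂ) z ∈ σ) :
    ∃ (D : Set ℂ) (n : ℕ) (γ : Fin n → ℝ → ℂ), IsOpen D ∧ Bornology.IsBounded D ∧ σ ⊆ D ∧
      (∀ z ∈ D, (starRingEnd ℂ) z ∈ D) ∧ Disjoint (closure D) L ∧ IsOrientedBoundary D γ := by
  obtain ⟨δ, hδ, hδL⟩ := hσ.exists_cthickening_subset_open hL.isOpen_compl
    hd.subset_compl_right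
  -- squares of side `δ / 2` stay within distance `δ` of `σ`
  have hr : 0 < δ / 2 := by linarith
  set r : ℝ := δ / 2 with hrδ
  have hr' : (r : ℂ) ≠ 0 := by exact_mod_cast hr.ne'
  obtain ⟨D, n, γ, hDo, hσD, hDc, hDd, hγ⟩ := exists_orientedBoundary_unit
    (σ := (fun z : ℂ => (r : ℂ)⁻¹ * z) '' σ) (hσ.image (by fun_prop)).isBounded (by
      rintro _ ⟨z, hz, rfl⟩
      exact ⟨_, hc z hz, by simp⟩)
  set f : ℂ ≃ₜ ℂ := Homeomorph.mulLeft₀ (r : ℂ) hr' with hf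
  have hfr : (fun z : ℂ => r * z) = f := rfl
  have hclose : closure ((fun z : ℂ => r * z) '' D) ⊆ Metric.cthickening δ σ := by
    rw [hfr, ← f.image_closure]
    rintro _ ⟨z, hz, rfl⟩
    obtain ⟨_, ⟨s, hs, rfl⟩, hzs⟩ := hDd z hz
    refine Metric.mem_cthickening_of_dist_le _ s _ _ hs ?_
    have e : (f z : ℂ) - s = r * (z - (r : ℂ)⁻¹ * s) := by
      change (r : ℂ) * z - s = _
      field_simp
    rw [dist_eq_norm, e, norm_mul, Complex.norm_real, Real.norm_of_nonneg hr.le, ← dist_eq_norm]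
    nlinarith
  refine ⟨(fun z : ℂ => r * z) '' D, n, fun k t => r * γ k t, ?_, ?_, ?_, ?_, ?_,
    isOrientedBoundary_smul hγ hr⟩
  · rw [hfr]
    exact f.isOpenMap D hDo
  · exact hσ.isBounded.cthickening.subset (subset_closure.trans hclose)
  · intro z hz
    exact ⟨(r : ℂ)⁻¹ * z, hσD ⟨z, hz, rfl⟩, by field_simp⟩
  · rintro _ ⟨z, hz, rfl⟩
    exact ⟨_, hDc z hz, by simp⟩
  · exact disjoint_left.mpr fun z hz hzL => hδL (hclose hz) hzL

end Grid

/-! ### Operators as complex linear maps on a slice -/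

section SlicePoint

theorem imagUnits_mul_self {I : ℍ[ℝ]} (hI : I ∈ imagUnits) : I * I = -1 := by
  have h := (Quaternion.sq_eq_neg_normSq (a := I)).mpr hI.1
  rw [← sq, h, Quaternion.normSq_eq_norm_mul_self, hI.2]
  simp

theorem star_imagUnits {I : ℍ[ℝ]} (hI : I ∈ imagUnits) : star I = -I :=
  Quaternion.star_eq_neg.mpr hI.1

theorem slicePoint_eq (I : ℍ[ℝ]) (z : ℂ) : slicePoint I z = (z.re : ℍ[ℝ]) + z.im • I := by
  rw [slicePoint, (Quaternion.coe_commutes z.im I).symm, Quaternion.coe_mul_eq_smul]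

theorem slicePoint_add (I : ℍ[ℝ]) (z w : ℂ) :
    slicePoint I (z + w) = slicePoint I z + slicePoint I w := by
  simp only [slicePoint_eq, Complex.add_re, Complex.add_im, Quaternion.coe_add, add_smul]
  abel

theorem slicePoint_ofReal (I : ℍ[ℝ]) (r : ℝ) : slicePoint I r = (r : ℍ[ℝ]) := by
  simp [slicePoint_eq]

theorem slicePoint_mul {I : ℍ[ℝ]} (hI : I ∈ imagUnits) (z w : ℂ) :
    slicePoint I (z * w) = slicePoint I z * slicePoint I w := by
  have h : ∀ r : ℝ, (r : ℍ[ℝ]) = r • (1 : ℍ[ℝ]) := fun r => by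
    rw [← Quaternion.algebraMap_def, Algebra.algebraMap_eq_smul_one]
  simp only [slicePoint_eq, Complex.mul_re, Complex.mul_im, h, add_mul, mul_add,
    smul_mul_smul_comm, imagUnits_mul_self hI, one_mul, mul_one]
  module

theorem slicePoint_conj {I : ℍ[ℝ]} (hI : I ∈ imagUnits) (z : ℂ) :
    slicePoint I ((starRingEnd ℂ) z) = star (slicePoint I z) := by
  simp [slicePoint_eq, star_imagUnits hI]

theorem re_slicePoint {I : ℍ[ℝ]} (hI : I ∈ imagUnits) (z : ℂ) : (slicePoint I z).re = z.re := by
  simp [slicePoint_eq, hI.1]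

theorem im_slicePoint {I : ℍ[ℝ]} (hI : I ∈ imagUnits) (z : ℂ) :
    (slicePoint I z).im = z.im • I := by
  have h : I.im = I := by
    have := Quaternion.re_add_im I
    rwa [hI.1, Quaternion.coe_zero, zero_add] at this
  simp [slicePoint_eq, h]

theorem norm_im_slicePoint {I : ℍ[ℝ]} (hI : I ∈ imagUnits) (z : ℂ) :
    ‖(slicePoint I z).im‖ = |z.im| := by
  rw [im_slicePoint hI, norm_smul, hI.2, mul_one, Real.norm_eq_abs]

theorem norm_slicePoint {I : ℍ[ℝ]} (hI : I ∈ imagUnits) (z : ℂ) : ‖slicePoint I z‖ = ‖z‖ := by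
  have h : slicePoint I z * star (slicePoint I z) = ((‖z‖ ^ 2 : ℝ) : ℍ[ℝ]) := by
    rw [← slicePoint_conj hI, ← slicePoint_mul hI, Complex.mul_conj, Complex.normSq_eq_norm_sq,
      slicePoint_ofReal]
  rw [Quaternion.self_mul_star, Quaternion.normSq_eq_norm_mul_self, Quaternion.coe_inj, ← sq] at h
  exact (sq_eq_sq₀ (norm_nonneg _) (norm_nonneg _)).mp h

theorem continuous_slicePoint (I : ℍ[ℝ]) : Continuous (slicePoint I) := by
  have : slicePoint I = fun z : ℂ => ((z.re : ℝ) : ℍ[ℝ]) + z.im • I := funext (slicePoint_eq I)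
  rw [this]
  exact (Quaternion.continuous_coe.comp Complex.continuous_re).add
    (Complex.continuous_im.smul continuous_const)

theorem exists_imagUnit : ∃ I : ℍ[ℝ], I ∈ imagUnits := by
  let I : ℍ[ℝ] := ⟨0, 1, 0, 0⟩
  refine ⟨I, rfl, ?_⟩
  rw [← sq_eq_sq₀ (norm_nonneg _) zero_le_one, sq, ← Quaternion.normSq_eq_norm_mul_self,
    Quaternion.normSq_def']
  simp [I]

end SlicePoint

section SliceModule

variable {A : Type*} [NormedRing A] [NormedAlgebra ℝ A]

/-- The algebra `A` as a complex Banach space, where `u + iv` acts as right multiplication by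
`(u + Iv)𝓘`. Left multiplications by elements of `A` are complex linear for this structure. -/
def SliceModule (ι : ℍ[ℝ] →ₐ[ℝ] A) (_ : ∀ s, ‖ι s‖ ≤ ‖s‖) (_ : imagUnits) : Type _ := A

variable {ι : ℍ[ℝ] →ₐ[ℝ] A} {hι : ∀ s, ‖ι s‖ ≤ ‖s‖} {I : imagUnits}

instance : NormedAddCommGroup (SliceModule ι hι I) := inferInstanceAs (NormedAddCommGroup A)

instance [CompleteSpace A] : CompleteSpace (SliceModule ι hι I) :=
  inferInstanceAs (CompleteSpace A)

instance : Module ℂ (SliceModule ι hι I) where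
  smul z := fun (a : A) => (a * ι (slicePoint I z) : A)
  one_smul := fun (a : A) => show a * ι (slicePoint I 1) = a by
    rw [← Complex.ofReal_one, slicePoint_ofReal, Quaternion.coe_one, map_one, mul_one]
  mul_smul z w := fun (a : A) => show a * ι (slicePoint I (z * w))
      = a * ι (slicePoint I w) * ι (slicePoint I z) by
    rw [mul_comm z w, slicePoint_mul I.2, map_mul, mul_assoc]
  smul_zero z := zero_mul (M₀ := A) _
  smul_add z := fun (a b : A) => add_mul a b _
  add_smul z w := fun (a : A) => show a * ι (slicePoint I (z + w))
      = a * ι (slicePoint I z) + a * ι (slicePoint I w) by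
    rw [slicePoint_add, map_add, mul_add]
  zero_smul := fun (a : A) => show a * ι (slicePoint I 0) = 0 by
    rw [← Complex.ofReal_zero, slicePoint_ofReal, Quaternion.coe_zero, map_zero, mul_zero]

instance : NormedSpace ℂ (SliceModule ι hι I) where
  norm_smul_le z := fun (a : A) => show ‖a * ι (slicePoint I z)‖ ≤ ‖z‖ * ‖a‖ by
    rw [mul_comm ‖z‖, ← norm_slicePoint I.2]
    exact (norm_mul_le _ _).trans (mul_le_mul_of_nonneg_left (hι _) (norm_nonneg _))

variable (hι I) in
/-- The identity of `A`, as a real linear isometry to the complex space `SliceModule ι hι I`. -/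
def toSlice : A ≃ₗᵢ[ℝ] SliceModule ι hι I where
  toFun a := a
  invFun a := a
  map_add' _ _ := rfl
  map_smul' r a := show (r • a : A) = a * ι (slicePoint I (r : ℂ)) by
    rw [slicePoint_ofReal, ← Quaternion.algebraMap_def, AlgHom.commutes, ← Algebra.commutes,
      Algebra.smul_def]
  left_inv _ := rfl
  right_inv _ := rfl
  norm_map' _ := rfl

theorem smul_toSlice (z : ℂ) (a : A) :
    z • toSlice hι I a = toSlice hι I (a * ι (slicePoint I z)) := rfl

variable (hι I) in
/-- Left multiplication by an element of `A`, as a complex linear operator. -/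
def sliceLeft : A →ₐ[ℝ] (SliceModule ι hι I →L[ℂ] SliceModule ι hι I) where
  toFun a := LinearMap.mkContinuous
    { toFun := fun v => toSlice hι I (a * (toSlice hι I).symm v)
      map_add' := fun v w => by simp [mul_add]
      map_smul' := fun z (v : A) => (mul_assoc a v (ι (slicePoint I z))).symm }
    ‖a‖ fun v => norm_mul_le (α := A) a v
  map_one' := by ext v; exact one_mul (M := A) v
  map_mul' a b := by ext v; exact mul_assoc (G := A) a b v
  map_zero' := by ext v; exact zero_mul (M₀ := A) v
  map_add' a b := by ext v; exact add_mul (R := A) a b v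
  commutes' r := by
    ext v
    change toSlice hι I (algebraMap ℝ A r * (toSlice hι I).symm v) = r • v
    rw [← Algebra.smul_def, map_smul, LinearIsometryEquiv.apply_symm_apply]

theorem sliceLeft_toSlice (a b : A) :
    sliceLeft hι I a (toSlice hι I b) = toSlice hι I (a * b) := rfl

theorem sliceLeft_injective : Function.Injective (sliceLeft hι I) := by
  intro a b h
  have h1 := congrArg (fun f : SliceModule ι hι I →L[ℂ] SliceModule ι hι I => f (toSlice hι I 1)) h
  simpa [sliceLeft_toSlice] using h1

end SliceModule

/-! ### The trace of the S-spectrum and symmetric cutoffs -/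

section PlanarSpectrum

variable {A : Type*} [NormedRing A] [NormedAlgebra ℝ A]

/-- `T² - 2 Re(z) T + |z|²`, for `z` in the coordinate plane `ℂ ≅ ℂ_I` of any slice. -/
def planarPoly (T : A) (z : ℂ) : A := T ^ 2 - (2 * z.re) • T + (‖z‖ ^ 2) • (1 : A)

/-- The trace of the S-spectrum on the slices, in the coordinate plane `ℂ ≅ ℂ_I`. -/
def planarSpectrum (T : A) : Set ℂ := {z | ¬ IsUnit (planarPoly T z)}

theorem sPoly_slicePoint (T : A) {I : ℍ[ℝ]} (hI : I ∈ imagUnits) (z : ℂ) :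
    sPoly T (slicePoint I z) = planarPoly T z := by
  rw [sPoly, planarPoly, re_slicePoint hI, norm_slicePoint hI]

theorem sliceSet_sSpectrum (T : A) {I : ℍ[ℝ]} (hI : I ∈ imagUnits) :
    sliceSet I (sSpectrum T) = planarSpectrum T := by
  ext z
  change ¬ IsUnit (sPoly T (slicePoint I z)) ↔ ¬ IsUnit (planarPoly T z)
  rw [sPoly_slicePoint T hI]

theorem planarPoly_conj (T : A) (z : ℂ) : planarPoly T ((starRingEnd ℂ) z) = planarPoly T z := by
  simp [planarPoly]

theorem continuous_planarPoly (T : A) : Continuous (planarPoly T) := by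
  unfold planarPoly
  fun_prop

theorem commute_planarPoly (T : A) (z : ℂ) : Commute T (planarPoly T z) :=
  (((Commute.refl T).pow_right 2).sub_right ((Commute.refl T).smul_right _)).add_right
    ((Commute.one_right T).smul_right _)

theorem commute_inverse_planarPoly (T : A) {z : ℂ} (hz : z ∉ planarSpectrum T) :
    Commute T (Ring.inverse (planarPoly T z)) := by
  obtain ⟨u, hu⟩ := not_not.mp hz
  rw [← hu, Ring.inverse_unit]
  exact Commute.units_inv_right (hu ▸ commute_planarPoly T z)

variable [CompleteSpace A]

theorem isClosed_planarSpectrum (T : A) : IsClosed (planarSpectrum T) :=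
  (Units.isOpen.preimage (continuous_planarPoly T)).isClosed_compl

theorem isBounded_planarSpectrum (T : A) : Bornology.IsBounded (planarSpectrum T) := by
  refine (Metric.isBounded_closedBall (x := (0 : ℂ)) (r := 3 * ‖T‖)).subset fun z hz => ?_
  rw [mem_closedBall_zero_iff]
  by_contra! h
  have hz0 : 0 < ‖z‖ := lt_of_le_of_lt (by positivity) h
  -- Neumann series: `‖z‖⁻² (T² - 2 Re(z) T + |z|²) = 1 - u` with `‖u‖ < 1`
  set u : A := (‖z‖ ^ 2)⁻¹ • ((2 * z.re) • T - T ^ 2) with hu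
  have h1 : planarPoly T z = algebraMap ℝ A (‖z‖ ^ 2) * (1 - u) := by
    rw [← Algebra.smul_def, hu, smul_sub, smul_smul, mul_inv_cancel₀ (by positivity), one_smul,
      planarPoly]
    abel
  have h2 : ‖u‖ < 1 := by
    rw [hu, norm_smul, norm_inv, Real.norm_of_nonneg (by positivity),
      inv_mul_lt_one₀ (by positivity)]
    calc ‖(2 * z.re) • T - T ^ 2‖ ≤ ‖(2 * z.re) • T‖ + ‖T ^ 2‖ := norm_sub_le _ _
      _ ≤ 2 * ‖z‖ * ‖T‖ + ‖T‖ ^ 2 := by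
        refine add_le_add ?_ (norm_pow_le' T two_pos)
        rw [norm_smul, norm_mul, Real.norm_eq_abs z.re, Real.norm_ofNat]
        gcongr
        exact Complex.abs_re_le_norm z
      _ < ‖z‖ ^ 2 := by nlinarith [norm_nonneg T]
  refine hz ?_
  rw [h1]
  exact ((IsUnit.mk0 (‖z‖ ^ 2) (by positivity)).map (algebraMap ℝ A)).mul
    (isUnit_one_sub_of_norm_lt_one h2)

theorem isCompact_planarSpectrum (T : A) : IsCompact (planarSpectrum T) :=
  Metric.isCompact_of_isClosed_isBounded (isClosed_planarSpectrum T) (isBounded_planarSpectrum T)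

end PlanarSpectrum

section Cutoff

variable {A : Type*} [NormedRing A] [NormedAlgebra ℝ A]

/-- Real cutoff functions, symmetric about the real axis, that are `1` near the points of the
planar spectrum in `s` and `0` near the other points of the planar spectrum. -/
structure IsSpectralCutoff (T : A) (s : Set ℂ) (χ : ℂ → ℝ) : Prop where
  contDiff : ContDiff ℝ 1 χ
  hasCompactSupport : HasCompactSupport χ
  conj : ∀ z, χ ((starRingEnd ℂ) z) = χ z
  eventually_one : ∀ z ∈ planarSpectrum T, z ∈ s → ∀ᶠ w in 𝓝 z, χ w = 1
  eventually_zero : ∀ z ∈ planarSpectrum T, z ∉ s → ∀ᶠ w in 𝓝 z, χ w = 0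

theorem IsSpectralCutoff.mul {T : A} {s t : Set ℂ} {χ ψ : ℂ → ℝ} (hχ : IsSpectralCutoff T s χ)
    (hψ : IsSpectralCutoff T t ψ) : IsSpectralCutoff T (s ∩ t) fun w => χ w * ψ w where
  contDiff := hχ.contDiff.mul hψ.contDiff
  hasCompactSupport := hχ.hasCompactSupport.mul_right
  conj z := by rw [hχ.conj, hψ.conj]
  eventually_one z hz hzs := by
    filter_upwards [hχ.eventually_one z hz hzs.1, hψ.eventually_one z hz hzs.2] with w h1 h2
    rw [h1, h2, mul_one]
  eventually_zero z hz hzs := by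
    by_cases h : z ∈ s
    · filter_upwards [hψ.eventually_zero z hz fun h' => hzs ⟨h, h'⟩] with w h1
      rw [h1, mul_zero]
    · filter_upwards [hχ.eventually_zero z hz h] with w h1
      rw [h1, zero_mul]

theorem IsSpectralCutoff.add {T : A} {s t : Set ℂ} {χ ψ : ℂ → ℝ} (hχ : IsSpectralCutoff T s χ)
    (hψ : IsSpectralCutoff T t ψ) (hd : Disjoint s t) :
    IsSpectralCutoff T (s ∪ t) fun w => χ w + ψ w where
  contDiff := hχ.contDiff.add hψ.contDiff
  hasCompactSupport := hχ.hasCompactSupport.add hψ.hasCompactSupport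
  conj z := by rw [hχ.conj, hψ.conj]
  eventually_one z hz hzs := by
    by_cases h : z ∈ s
    · filter_upwards [hχ.eventually_one z hz h,
        hψ.eventually_zero z hz (disjoint_left.mp hd h)] with w h1 h2
      rw [h1, h2, add_zero]
    · filter_upwards [hχ.eventually_zero z hz h,
        hψ.eventually_one z hz (hzs.resolve_left h)] with w h1 h2
      rw [h1, h2, zero_add]
  eventually_zero z hz hzs := by
    filter_upwards [hχ.eventually_zero z hz fun h => hzs (Or.inl h),
      hψ.eventually_zero z hz fun h => hzs (Or.inr h)] with w h1 h2
    rw [h1, h2, add_zero]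

theorem isSpectralCutoff_zero (T : A) : IsSpectralCutoff T ∅ fun _ => 0 where
  contDiff := contDiff_const
  hasCompactSupport := HasCompactSupport.zero
  conj _ := rfl
  eventually_one _ _ h := h.elim
  eventually_zero _ _ _ := Eventually.of_forall fun _ => rfl

theorem exists_isSpectralCutoff {T : A} {s : Set ℂ} (hs : IsCompact s)
    (hs' : IsClosed (planarSpectrum T \ s)) (hc : ∀ z ∈ s, (starRingEnd ℂ) z ∈ s) :
    ∃ χ, IsSpectralCutoff T s χ := by
  obtain ⟨f, hf, hfs, hf0, hf1⟩ := exists_smooth_cutoff hs' hs disjoint_sdiff_left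
  have hcs : ∀ z, (starRingEnd ℂ) z ∈ s ↔ z ∈ s := fun z =>
    ⟨fun h => by simpa using hc _ h, hc z⟩
  have hcT : ∀ z, (starRingEnd ℂ) z ∈ planarSpectrum T ↔ z ∈ planarSpectrum T := fun z => by
    simp only [planarSpectrum, mem_ofPred_eq, planarPoly_conj]
  -- symmetrize an arbitrary cutoff
  refine ⟨fun w => 2⁻¹ * (f w + f ((starRingEnd ℂ) w)), ?_, ?_, fun z => ?_, fun z hz hzs => ?_,
    fun z hz hzs => ?_⟩
  · exact contDiff_const.mul (hf.add (hf.comp Complex.conjCLE.contDiff))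
  · exact (hfs.add (hfs.comp_homeomorph Complex.conjLIE.toHomeomorph)).mul_left
  · rw [Complex.conj_conj, add_comm]
  · filter_upwards [hf1 z hzs, Complex.continuous_conj.continuousAt.eventually
      (hf1 _ (hc z hzs))] with w h1 h2
    rw [h1, h2]
    norm_num
  · filter_upwards [hf0 z ⟨hz, hzs⟩, Complex.continuous_conj.continuousAt.eventually
      (hf0 _ ⟨(hcT z).mpr hz, fun h => hzs ((hcs z).mp h)⟩)] with w h1 h2
    rw [h1, h2]
    norm_num

/-- The real part of `∂̄χ(z) (z - T)⁻¹`, where `(z - T)⁻¹` stands for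
`(T² - 2 Re(z) T + |z|²)⁻¹ (z̄ - T)` and a real and an imaginary part in `A` are told apart
formally. -/
def cutoffDensity (T : A) (χ : ℂ → ℝ) (z : ℂ) : A :=
  Ring.inverse (planarPoly T z) * ((2⁻¹ * fderiv ℝ χ z 1) • (z.re • 1 - T)
    + (2⁻¹ * fderiv ℝ χ z Complex.I * z.im) • 1)

/-- The imaginary part of `∂̄χ(z) (z - T)⁻¹`, in the same sense as for `cutoffDensity`. -/
def cutoffDensityIm (T : A) (χ : ℂ → ℝ) (z : ℂ) : A :=
  Ring.inverse (planarPoly T z) * ((2⁻¹ * fderiv ℝ χ z Complex.I) • (z.re • 1 - T)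
    - (2⁻¹ * fderiv ℝ χ z 1 * z.im) • 1)

/-- The area integral `-(1/π) ∫ ∂̄χ(z) (z - T)⁻¹ dA(z)` for symmetric `χ`; it only involves the
real part of the integrand, so that it can be formed in the real algebra `A`. -/
def rieszElement (T : A) (χ : ℂ → ℝ) : A := (-(Real.pi)⁻¹ : ℝ) • ∫ z, cutoffDensity T χ z

theorem IsSpectralCutoff.fderiv_eq_zero {T : A} {s : Set ℂ} {χ : ℂ → ℝ}
    (hχ : IsSpectralCutoff T s χ) {z : ℂ} (hz : z ∈ planarSpectrum T) :
    ∀ᶠ w in 𝓝 z, fderiv ℝ χ w = 0 := by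
  by_cases h : z ∈ s
  · filter_upwards [(hχ.eventually_one z hz h).eventually_nhds] with w hw
    rw [Filter.EventuallyEq.fderiv_eq (f := fun _ => (1 : ℝ)) hw]
    simp
  · filter_upwards [(hχ.eventually_zero z hz h).eventually_nhds] with w hw
    rw [Filter.EventuallyEq.fderiv_eq (f := fun _ => (0 : ℝ)) hw]
    simp

theorem IsSpectralCutoff.fderiv_conj {T : A} {s : Set ℂ} {χ : ℂ → ℝ}
    (hχ : IsSpectralCutoff T s χ) (z v : ℂ) :
    fderiv ℝ χ ((starRingEnd ℂ) z) v = fderiv ℝ χ z ((starRingEnd ℂ) v) := by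
  have h1 : χ = fun w => χ (Complex.conjCLE w) := funext fun w => (hχ.conj w).symm
  have h2 : fderiv ℝ (fun w => χ (Complex.conjCLE w)) z = _ :=
    Complex.conjCLE.comp_right_fderiv (f := χ) (x := z)
  rw [← h1] at h2
  rw [h2]
  simp

/-- Complex conjugation maps `∂̄χ(z) (z - T)⁻¹` to its conjugate for symmetric `χ`. This makes the
Riesz projector independent of the slice, as its imaginary part would be the only part that
involves `I`. -/
theorem IsSpectralCutoff.integral_cutoffDensityIm {T : A} {s : Set ℂ} {χ : ℂ → ℝ}
    (hχ : IsSpectralCutoff T s χ) : ∫ z, cutoffDensityIm T χ z = 0 := by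
  have h1 : ∀ z, cutoffDensityIm T χ ((starRingEnd ℂ) z) = -cutoffDensityIm T χ z := fun z => by
    simp only [cutoffDensityIm, planarPoly_conj, hχ.fderiv_conj, Complex.conj_I, map_one, map_neg,
      Complex.conj_re, Complex.conj_im]
    rw [← mul_neg]
    congr 1
    module
  have h2 := Complex.conjLIE.measurePreserving.integral_comp
    Complex.conjLIE.toHomeomorph.measurableEmbedding (cutoffDensityIm T χ)
  have h3 : ∀ z, Complex.conjLIE z = (starRingEnd ℂ) z := fun z => rfl
  simp only [h3, h1] at h2
  rw [integral_neg] at h2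
  have h4 : (2 : ℝ) • ∫ z, cutoffDensityIm T χ z = 0 := by
    rw [two_smul]
    nth_rewrite 1 [← h2]
    exact neg_add_cancel _
  exact (smul_eq_zero.mp h4).resolve_left two_ne_zero

variable [CompleteSpace A]

theorem IsSpectralCutoff.integrable_inverse_mul {T : A} {s : Set ℂ} {χ : ℂ → ℝ}
    (hχ : IsSpectralCutoff T s χ) {f : ℂ → A} (hf : Continuous f)
    (h0 : ∀ z, fderiv ℝ χ z = 0 → f z = 0) :
    Integrable fun z => Ring.inverse (planarPoly T z) * f z := by
  refine Continuous.integrable_of_hasCompactSupport ?_ ?_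
  · rw [continuous_iff_continuousAt]
    intro z
    by_cases hz : z ∈ planarSpectrum T
    · refine (continuousAt_const (y := (0 : A))).congr ?_
      filter_upwards [hχ.fderiv_eq_zero hz] with w hw
      rw [h0 w hw, mul_zero]
    · obtain ⟨u, hu⟩ := not_not.mp hz
      have h1 : ContinuousAt Ring.inverse (planarPoly T z) := hu ▸ NormedRing.inverse_continuousAt u
      exact (h1.comp (continuous_planarPoly T).continuousAt).mul hf.continuousAt
  · refine HasCompactSupport.intro (hχ.hasCompactSupport.fderiv ℝ) fun z hz => ?_
    rw [h0 z (image_eq_zero_of_notMem_tsupport hz), mul_zero]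

theorem IsSpectralCutoff.integrable_cutoffDensity {T : A} {s : Set ℂ} {χ : ℂ → ℝ}
    (hχ : IsSpectralCutoff T s χ) : Integrable (cutoffDensity T χ) := by
  have hD := hχ.contDiff.continuous_fderiv one_ne_zero
  exact hχ.integrable_inverse_mul (by fun_prop) fun z hz => by simp [hz]

theorem IsSpectralCutoff.integrable_cutoffDensityIm {T : A} {s : Set ℂ} {χ : ℂ → ℝ}
    (hχ : IsSpectralCutoff T s χ) : Integrable (cutoffDensityIm T χ) := by
  have hD := hχ.contDiff.continuous_fderiv one_ne_zero
  exact hχ.integrable_inverse_mul (by fun_prop) fun z hz => by simp [hz]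

end Cutoff

/-! ### The Riesz integral as an area integral -/

theorem dbar_ofReal {χ : ℂ → ℝ} {z : ℂ} (h : DifferentiableAt ℝ χ z) :
    dbar (fun w => (χ w : ℂ)) z =
      2⁻¹ * ((fderiv ℝ χ z 1 : ℝ) + Complex.I * (fderiv ℝ χ z Complex.I : ℝ)) := by
  have h1 : HasFDerivAt (fun w => (χ w : ℂ)) (Complex.ofRealCLM.comp (fderiv ℝ χ z)) z :=
    Complex.ofRealCLM.hasFDerivAt.comp z h.hasFDerivAt
  simp [dbar, h1.fderiv]

section Slice

variable {A : Type*} [NormedRing A] [NormedAlgebra ℝ A]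
  {ι : ℍ[ℝ] →ₐ[ℝ] A} {hι : ∀ s, ‖ι s‖ ≤ ‖s‖} {I : imagUnits}

/-- On a slice, where `z` is central, `T² - 2 Re(z) T + |z|²` factors as `(z - T) (z̄ - T)`. -/
theorem resolvent_sliceLeft {T : A} {z : ℂ} (hz : z ∉ planarSpectrum T) :
    z ∉ spectrum ℂ (sliceLeft hι I T) ∧ resolvent (sliceLeft hι I T) z =
      sliceLeft hι I (Ring.inverse (planarPoly T z)) *
        (algebraMap ℂ _ ((starRingEnd ℂ) z) - sliceLeft hι I T) := by
  set B := SliceModule ι hι I →L[ℂ] SliceModule ι hι I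
  set a : B := sliceLeft hι I T with ha
  set q : B := sliceLeft hι I (planarPoly T z) with hq
  set r : B := sliceLeft hι I (Ring.inverse (planarPoly T z)) with hr
  set Z : B := algebraMap ℂ B z with hZ
  set Z' : B := algebraMap ℂ B ((starRingEnd ℂ) z) with hZ'
  have hu : IsUnit (planarPoly T z) := not_not.mp hz
  have hrq : r * q = 1 := by rw [hr, hq, ← map_mul, Ring.inverse_mul_cancel _ hu, map_one]
  have har : a * r = r * a := by
    rw [ha, hr, ← map_mul, (commute_inverse_planarPoly T hz).eq, map_mul]
  have hcZ : ∀ x : B, Z * x = x * Z := fun x => Algebra.commutes _ x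
  have hcZ' : ∀ x : B, Z' * x = x * Z' := fun x => Algebra.commutes _ x
  have hsum : Z + Z' = algebraMap ℝ B (2 * z.re) := by
    rw [hZ, hZ', ← map_add, Complex.add_conj, IsScalarTower.algebraMap_apply ℝ ℂ B]
    simp
  have hmul : Z * Z' = algebraMap ℝ B (‖z‖ ^ 2) := by
    rw [hZ, hZ', ← map_mul, Complex.mul_conj, Complex.normSq_eq_norm_sq,
      IsScalarTower.algebraMap_apply ℝ ℂ B]
    rfl
  have hqe : q = a ^ 2 - (Z + Z') * a + Z * Z' := by
    rw [hq, planarPoly, map_add, map_sub, map_smul, map_smul, map_pow, map_one, hsum, hmul,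
      ← Algebra.smul_def, Algebra.algebraMap_eq_smul_one]
  have h1 : (Z - a) * (Z' - a) = q := by
    rw [hqe, sub_mul, mul_sub, mul_sub, add_mul, ← hcZ' a]
    noncomm_ring
  have h2 : (Z' - a) * (Z - a) = q := by
    rw [hqe, sub_mul, mul_sub, mul_sub, add_mul, ← hcZ a, ← hcZ Z']
    noncomm_ring
  have h3 : (Z - a) * (r * (Z' - a)) = 1 := by
    rw [← mul_assoc, sub_mul, hcZ, har, ← mul_sub, mul_assoc, h1, hrq]
  have h4 : (r * (Z' - a)) * (Z - a) = 1 := by rw [mul_assoc, h2, hrq]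
  have hmem := spectrum.mem_resolventSet_of_left_right_inverse h3 h4
  refine ⟨not_not.mpr hmem, ?_⟩
  have h5 : resolvent a z * (Z - a) = 1 := Ring.inverse_mul_cancel _ hmem
  rw [← mul_one (resolvent a z), ← h3, ← mul_assoc, h5, one_mul]

theorem resolvent_sliceLeft_apply {T : A} {z : ℂ} (hz : z ∉ planarSpectrum T) (b : A) :
    resolvent (sliceLeft hι I T) z (toSlice hι I b) =
      toSlice hι I (Ring.inverse (planarPoly T z) * ((z.re • 1 - T) * b)) -
        ((z.im : ℂ) * Complex.I) • toSlice hι I (Ring.inverse (planarPoly T z) * b) := by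
  have hconj : (starRingEnd ℂ) z = z.re - z.im * Complex.I := by
    apply Complex.ext <;> simp
  have h1 : (starRingEnd ℂ) z • toSlice hι I b - toSlice hι I (T * b) =
      toSlice hι I ((z.re • 1 - T) * b) - ((z.im : ℂ) * Complex.I) • toSlice hι I b := by
    rw [hconj, sub_smul, Complex.coe_smul, ← map_smul (toSlice hι I), sub_mul, map_sub,
      smul_one_mul]
    abel
  rw [(resolvent_sliceLeft hz).2, mul_apply_eq_comp, _root_.sub_apply,
    sliceLeft_toSlice, Algebra.algebraMap_eq_smul_one, _root_.smul_apply,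
    one_apply_eq_self, h1, map_sub, map_smul, sliceLeft_toSlice,
    sliceLeft_toSlice]

theorem spectrum_sliceLeft_subset (T : A) :
    spectrum ℂ (sliceLeft hι I T) ⊆ planarSpectrum T := fun _ hz => by
  by_contra h
  exact (resolvent_sliceLeft h).1 hz

theorem IsSpectralCutoff.isCutoff {T : A} {s : Set ℂ} {χ : ℂ → ℝ} (hχ : IsSpectralCutoff T s χ) :
    IsCutoff (sliceLeft hι I T) fun w => (χ w : ℂ) where
  contDiff := contDiff_ofReal hχ.contDiff
  hasCompactSupport := hasCompactSupport_ofReal hχ.hasCompactSupport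
  eventually_eq z hz := by
    have hz' := spectrum_sliceLeft_subset T hz
    by_cases h : z ∈ s
    · have h1 := hχ.eventually_one z hz' h
      filter_upwards [h1] with w hw
      rw [hw, h1.self_of_nhds]
    · have h1 := hχ.eventually_zero z hz' h
      filter_upwards [h1] with w hw
      rw [hw, h1.self_of_nhds]

/-- The integrand of the planar calculus of left multiplication by `T`, split into its real and
imaginary parts. -/
theorem dbar_smul_resolvent_apply {T : A} {s : Set ℂ} {χ : ℂ → ℝ} (hχ : IsSpectralCutoff T s χ)
    (z : ℂ) (b : A) :
    (dbar (fun w => (χ w : ℂ)) z • resolvent (sliceLeft hι I T) z) (toSlice hι I b) =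
      toSlice hι I (cutoffDensity T χ z * b) +
        Complex.I • toSlice hι I (cutoffDensityIm T χ z * b) := by
  rw [dbar_ofReal (hχ.contDiff.differentiable one_ne_zero z)]
  by_cases hz : z ∈ planarSpectrum T
  · have h := (hχ.fderiv_eq_zero hz).self_of_nhds
    simp [cutoffDensity, cutoffDensityIm, h]
  · have e1 : cutoffDensity T χ z * b = (2⁻¹ * fderiv ℝ χ z 1) •
        (Ring.inverse (planarPoly T z) * ((z.re • 1 - T) * b)) +
        (2⁻¹ * fderiv ℝ χ z Complex.I * z.im) • (Ring.inverse (planarPoly T z) * b) := by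
      rw [cutoffDensity, mul_assoc, add_mul, mul_add, smul_mul_assoc, mul_smul_comm,
        smul_one_mul, mul_smul_comm]
    have e2 : cutoffDensityIm T χ z * b = (2⁻¹ * fderiv ℝ χ z Complex.I) •
        (Ring.inverse (planarPoly T z) * ((z.re • 1 - T) * b)) -
        (2⁻¹ * fderiv ℝ χ z 1 * z.im) • (Ring.inverse (planarPoly T z) * b) := by
      rw [cutoffDensityIm, mul_assoc, sub_mul, mul_sub, smul_mul_assoc, mul_smul_comm,
        smul_one_mul, mul_smul_comm]
    rw [_root_.smul_apply, resolvent_sliceLeft_apply hz, e1, e2]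
    simp only [map_add, map_sub, map_smul]
    simp only [← Complex.coe_smul]
    match_scalars
    · ring
    · linear_combination (-2⁻¹ * (fderiv ℝ χ z Complex.I : ℂ) * z.im) * Complex.I_sq

/-- The `S`-resolvent operator is an ordinary resolvent applied to `1`: a quaternion of the slice
that stands to the right of an operator is a complex scalar. -/
theorem leftSResolvent_eq {T : A} {z : ℂ} (hz : z ∉ planarSpectrum T) :
    toSlice hι I (leftSResolvent ι T (slicePoint I z)) =
      resolvent (sliceLeft hι I T) z (toSlice hι I 1) := by
  rw [(resolvent_sliceLeft hz).2, mul_apply_eq_comp, _root_.sub_apply,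
    sliceLeft_toSlice, Algebra.algebraMap_eq_smul_one, _root_.smul_apply,
    one_apply_eq_self, smul_toSlice, ← map_sub, sliceLeft_toSlice, leftSResolvent,
    sPoly_slicePoint T I.2, slicePoint_conj I.2, one_mul, mul_one, ← mul_neg, neg_sub]

variable [CompleteSpace A]

/-- The complex calculus of left multiplication by `T` gives left multiplication by an element of
`A`, which does not depend on the slice. -/
theorem sliceLeft_rieszElement {T : A} {s : Set ℂ} {χ : ℂ → ℝ} (hχ : IsSpectralCutoff T s χ) :
    sliceLeft hι I (rieszElement T χ) =
      planarCalculus (sliceLeft hι I T) fun w => (χ w : ℂ) := by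
  ext v
  obtain ⟨b, rfl⟩ := (toSlice hι I).surjective v
  have hi : ∀ f : ℂ → A, Integrable f → Integrable (fun z => toSlice hι I (f z * b)) := fun f hf =>
    (toSlice hι I).toContinuousLinearEquiv.toContinuousLinearMap.integrable_comp
      (((ContinuousLinearMap.mul ℝ A).flip b).integrable_comp hf)
  have hint : ∀ f : ℂ → A, Integrable f →
      ∫ z, toSlice hι I (f z * b) = toSlice hι I ((∫ z, f z) * b) := fun f hf => by
    have h1 := (toSlice hι I).toContinuousLinearEquiv.integral_comp_comm (μ := volume)
      fun z => f z * b
    have h2 := ((ContinuousLinearMap.mul ℝ A).flip b).integral_comp_comm hf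
    simp only [ContinuousLinearMap.flip_apply, ContinuousLinearMap.mul_apply'] at h2
    rw [h2] at h1
    exact h1
  have hre := hχ.integrable_cutoffDensity
  have him := hχ.integrable_cutoffDensityIm
  have him' : Integrable fun z => Complex.I • toSlice hι I (cutoffDensityIm T χ z * b) :=
    (hi _ him).fun_smul _
  rw [planarCalculus, _root_.smul_apply,
    ContinuousLinearMap.integral_apply hχ.isCutoff.integrable]
  simp only [dbar_smul_resolvent_apply hχ]
  rw [integral_add (hi _ hre) him', integral_smul, hint _ hre, hint _ him,
    hχ.integral_cutoffDensityIm, zero_mul, map_zero, smul_zero, add_zero, sliceLeft_toSlice,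
    rieszElement, smul_mul_assoc, map_smul, ← Complex.coe_smul]
  simp

/-- The Riesz integral is the calculus of `T` for every suitable cutoff, whatever the contour and
the slice. -/
theorem rieszIntegral_eq_rieszElement (hι : ∀ s, ‖ι s‖ ≤ ‖s‖) {T : A} {σ Ω : Set ℍ[ℝ]} {n : ℕ}
    {γ : Fin n → ℝ → ℂ} (h : IsRieszContour T σ Ω γ) {I : ℍ[ℝ]} (hI : I ∈ imagUnits) {χ : ℂ → ℝ}
    (hχ : IsSpectralCutoff T (sliceSet I σ) χ) : rieszIntegral ι T I γ = rieszElement T χ := by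
  lift I to imagUnits using hI
  set D := sliceSet I Ω with hD
  have hπ : (Real.pi : ℂ) ≠ 0 := by exact_mod_cast Real.pi_ne_zero
  have hor := h.isOrientedBoundary I I.2
  have hDo : IsOpen D := h.isOpen.preimage (continuous_slicePoint I)
  have hDb : Bornology.IsBounded D := by
    obtain ⟨R, hR⟩ := h.isBounded.subset_closedBall 0
    refine (Metric.isBounded_closedBall (x := (0 : ℂ)) (r := R)).subset fun z hz => ?_
    have := mem_closedBall_zero_iff.mp (hR hz)
    rwa [norm_slicePoint I.2, ← mem_closedBall_zero_iff] at this
  have hfr : ∀ z ∈ frontier D, z ∉ planarSpectrum T := fun z hz hzT =>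
    h.frontier_subset I I.2 z hz ((sliceSet_sSpectrum T I.2).symm.subset hzT)
  have hDσ : ∀ z ∈ planarSpectrum T, (z ∈ D ↔ z ∈ sliceSet I σ) := by
    intro z hz
    rw [← sliceSet_sSpectrum T I.2] at hz
    change _ ↔ slicePoint I z ∈ σ
    rw [← h.inter_sSpectrum]
    exact ⟨fun hh => ⟨hh, hz⟩, fun hh => hh.1⟩
  have hsub := spectrum_sliceLeft_subset (hι := hι) (I := I) T
  have hmain := contourIntegral_resolvent hor hDo hDb (fun z hz hz' => hfr z hz (hsub hz'))
    (hχ.isCutoff (hι := hι) (I := I))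
    (fun z hz hzD => by
      filter_upwards [hχ.eventually_one z (hsub hz) ((hDσ z (hsub hz)).mp hzD)] with w hw
      simp [hw])
    (fun z hz hzD => by
      filter_upwards [hχ.eventually_zero z (hsub hz)
        (fun hh => hzD ((hDσ z (hsub hz)).mpr hh))] with w hw
      simp [hw])
  rw [← sliceLeft_rieszElement hχ] at hmain
  have hmem : ∀ k, ∀ t ∈ Icc (0 : ℝ) 1, γ k t ∉ planarSpectrum T := fun k t ht =>
    hfr _ (hor.image_eq ▸ mem_iUnion.mpr ⟨k, t, ht, rfl⟩)
  -- the integrand of `rieszIntegral`, seen in the complex Banach space of the slice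
  have harc : ∀ k, toSlice hι I (∫ t in (0 : ℝ)..1, leftSResolvent ι T (slicePoint I (γ k t)) *
      ι (-(slicePoint I (deriv (γ k) t) * I))) = (-Complex.I) •
      (∫ t in (0 : ℝ)..1, deriv (γ k) t • resolvent (sliceLeft hι I T) (γ k t))
        (toSlice hι I 1) := by
    intro k
    have hint : IntervalIntegrable
        (fun t => deriv (γ k) t • resolvent (sliceLeft hι I T) (γ k t)) volume 0 1 := by
      refine (intervalIntegrable_deriv (hor.contDiffOn k)).smul_continuousOn ?_
      rw [uIcc_of_le zero_le_one]
      intro t ht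
      exact ContinuousAt.comp_continuousWithinAt (g := resolvent (sliceLeft hι I T))
        (differentiableAt_resolvent
        fun hz => hmem k t ht (hsub hz)).continuousAt ((hor.contDiffOn k).continuousOn t ht)
    rw [ContinuousLinearMap.intervalIntegral_apply hint, ← intervalIntegral.integral_smul]
    simp only [intervalIntegral.integral_of_le zero_le_one]
    have h1 := (toSlice hι I).toContinuousLinearEquiv.integral_comp_comm
      (μ := volume.restrict (Ioc (0 : ℝ) 1)) fun t => leftSResolvent ι T (slicePoint I (γ k t)) *
      ι (-(slicePoint I (deriv (γ k) t) * I))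
    refine h1.symm.trans (setIntegral_congr_fun measurableSet_Ioc fun t ht => ?_)
    have h2 : -(slicePoint I (deriv (γ k) t) * I) =
        slicePoint I (-Complex.I * deriv (γ k) t) := by
      have h3 : (I : ℍ[ℝ]) = slicePoint I Complex.I := by simp [slicePoint_eq]
      nth_rewrite 2 [h3]
      rw [← slicePoint_mul I.2, ← neg_one_mul, show (-1 : ℍ[ℝ]) = slicePoint I (-1 : ℂ) by
        simp [slicePoint_eq], ← slicePoint_mul I.2]
      congr 1
      ring
    change toSlice hι I _ = _
    rw [h2, ← smul_toSlice, leftSResolvent_eq (hmem k t (Ioc_subset_Icc_self ht)), mul_smul]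
    rfl
  apply (toSlice hι I).injective
  rw [rieszIntegral, map_smul, map_sum, Finset.sum_congr rfl fun k _ => harc k,
    ← Finset.smul_sum, ← _root_.sum_apply, hmain, _root_.smul_apply,
    sliceLeft_toSlice, mul_one, ← Complex.coe_smul, smul_smul, smul_smul]
  have : ((1 / (2 * Real.pi) : ℝ) : ℂ) * -Complex.I * (2 * Real.pi * Complex.I) = 1 := by
    push_cast
    field_simp
    linear_combination (-1 : ℂ) * Complex.I_sq
  rw [this, one_smul]

end Slice

/-! ### Riesz projectors -/

section AxialSymmetry

/-- An axially symmetric set is determined by its trace on any one slice. -/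
theorem AxiallySymmetric.mem_sliceSet_iff {Ω : Set ℍ[ℝ]} (h : AxiallySymmetric Ω) {I : ℍ[ℝ]}
    (hI : I ∈ imagUnits) (q : ℍ[ℝ]) : (⟨q.re, ‖q.im‖⟩ : ℂ) ∈ sliceSet I Ω ↔ q ∈ Ω := by
  have h1 : (slicePoint I ⟨q.re, ‖q.im‖⟩).re = q.re := re_slicePoint hI _
  have h2 : ‖(slicePoint I ⟨q.re, ‖q.im‖⟩).im‖ = ‖q.im‖ := by
    rw [norm_im_slicePoint hI, abs_of_nonneg (norm_nonneg _)]
  exact ⟨fun hq => h _ hq q h1.symm h2.symm, fun hq => h q hq _ h1 h2⟩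

theorem AxiallySymmetric.sliceSet_eq {Ω : Set ℍ[ℝ]} (h : AxiallySymmetric Ω) {I J : ℍ[ℝ]}
    (hI : I ∈ imagUnits) (hJ : J ∈ imagUnits) : sliceSet I Ω = sliceSet J Ω := by
  ext z
  have h1 : (slicePoint I z).re = (slicePoint J z).re := by
    rw [re_slicePoint hI, re_slicePoint hJ]
  have h2 : ‖(slicePoint I z).im‖ = ‖(slicePoint J z).im‖ := by
    rw [norm_im_slicePoint hI, norm_im_slicePoint hJ]
  exact ⟨fun hz => h _ hz _ h1.symm h2.symm, fun hz => h _ hz _ h1 h2⟩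

theorem AxiallySymmetric.conj_mem_sliceSet {Ω : Set ℍ[ℝ]} (h : AxiallySymmetric Ω) {I : ℍ[ℝ]}
    (hI : I ∈ imagUnits) {z : ℂ} (hz : z ∈ sliceSet I Ω) : (starRingEnd ℂ) z ∈ sliceSet I Ω := by
  refine h _ hz _ ?_ ?_
  · rw [re_slicePoint hI, re_slicePoint hI, Complex.conj_re]
  · rw [norm_im_slicePoint hI, norm_im_slicePoint hI, Complex.conj_im, abs_neg]

/-- The axially symmetric set whose trace on each slice is `D`, for `D` symmetric about the real
axis. -/
def axialHull (D : Set ℂ) : Set ℍ[ℝ] := {q | (⟨q.re, ‖q.im‖⟩ : ℂ) ∈ D}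

theorem axiallySymmetric_axialHull (D : Set ℂ) : AxiallySymmetric (axialHull D) := by
  intro q hq p h1 h2
  change (⟨p.re, ‖p.im‖⟩ : ℂ) ∈ D
  rw [h1, h2]
  exact hq

theorem continuous_axialCoordinate : Continuous fun q : ℍ[ℝ] => (⟨q.re, ‖q.im‖⟩ : ℂ) := by
  have h : (fun q : ℍ[ℝ] => (⟨q.re, ‖q.im‖⟩ : ℂ)) =
      fun q => Complex.equivRealProdCLM.symm (q.re, ‖q.im‖) := rfl
  rw [h]
  exact Complex.equivRealProdCLM.symm.continuous.comp
    (Quaternion.continuous_re.prodMk Quaternion.continuous_im.norm)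

theorem norm_axialCoordinate (q : ℍ[ℝ]) : ‖(⟨q.re, ‖q.im‖⟩ : ℂ)‖ = ‖q‖ := by
  rw [← sq_eq_sq₀ (norm_nonneg _) (norm_nonneg _), ← Complex.normSq_eq_norm_sq, Complex.normSq_mk,
    sq, ← Quaternion.normSq_eq_norm_mul_self, ← Quaternion.normSq_eq_norm_mul_self,
    Quaternion.normSq_def', Quaternion.normSq_def']
  simp
  ring

theorem sliceSet_axialHull {D : Set ℂ} (hD : ∀ z ∈ D, (starRingEnd ℂ) z ∈ D) {I : ℍ[ℝ]}
    (hI : I ∈ imagUnits) : sliceSet I (axialHull D) = D := by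
  ext z
  change (⟨(slicePoint I z).re, ‖(slicePoint I z).im‖⟩ : ℂ) ∈ D ↔ z ∈ D
  rw [re_slicePoint hI, norm_im_slicePoint hI]
  rcases le_total 0 z.im with h | h
  · rw [abs_of_nonneg h]
  · rw [abs_of_nonpos h]
    have h1 : (⟨z.re, -z.im⟩ : ℂ) = (starRingEnd ℂ) z := rfl
    rw [h1]
    exact ⟨fun hz => by simpa using hD _ hz, hD z⟩

end AxialSymmetry

section Projector

variable {A : Type*} [NormedRing A] [NormedAlgebra ℝ A]

theorem planarPoly_axialCoordinate (T : A) (q : ℍ[ℝ]) :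
    planarPoly T ⟨q.re, ‖q.im‖⟩ = sPoly T q := by
  rw [planarPoly, sPoly, norm_axialCoordinate]

theorem axiallySymmetric_sSpectrum (T : A) : AxiallySymmetric (sSpectrum T) := by
  intro q hq p h1 h2
  change ¬ IsUnit (sPoly T p)
  rw [← planarPoly_axialCoordinate, h1, h2, planarPoly_axialCoordinate]
  exact hq

theorem isSSpectralSet_sSpectrum (T : A) : IsSSpectralSet T (sSpectrum T) :=
  ⟨subset_rfl, axiallySymmetric_sSpectrum T, by
    rw [Subtype.coe_preimage_self]
    exact isClopen_univ⟩

theorem isSSpectralSet_empty (T : A) : IsSSpectralSet T ∅ :=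
  ⟨empty_subset _, fun _ h => h.elim, isClopen_empty⟩

theorem IsSSpectralSet.union {T : A} {σ δ : Set ℍ[ℝ]} (hσ : IsSSpectralSet T σ)
    (hδ : IsSSpectralSet T δ) : IsSSpectralSet T (σ ∪ δ) :=
  ⟨union_subset hσ.subset hδ.subset, fun q hq p h1 h2 => hq.imp
    (fun h => hσ.axiallySymmetric q h p h1 h2) fun h => hδ.axiallySymmetric q h p h1 h2,
    hσ.isClopen.union hδ.isClopen⟩

theorem IsSSpectralSet.inter {T : A} {σ δ : Set ℍ[ℝ]} (hσ : IsSSpectralSet T σ)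
    (hδ : IsSSpectralSet T δ) : IsSSpectralSet T (σ ∩ δ) :=
  ⟨inter_subset_left.trans hσ.subset, fun q hq p h1 h2 =>
    ⟨hσ.axiallySymmetric q hq.1 p h1 h2, hδ.axiallySymmetric q hq.2 p h1 h2⟩,
    hσ.isClopen.inter hδ.isClopen⟩

variable [CompleteSpace A]

theorem isClosed_sSpectrum (T : A) : IsClosed (sSpectrum T) := by
  have h : Continuous (sPoly T) := by
    have h1 := Quaternion.continuous_re
    unfold sPoly
    fun_prop
  exact (Units.isOpen.preimage h).isClosed_compl

theorem IsSSpectralSet.isClosed {T : A} {σ : Set ℍ[ℝ]} (hσ : IsSSpectralSet T σ) :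
    IsClosed σ := by
  have h := (isClosed_sSpectrum T).isClosedMap_subtype_val _ hσ.isClopen.isClosed
  rwa [Subtype.image_preimage_coe, inter_eq_right.mpr hσ.subset] at h

theorem IsSSpectralSet.isClosed_sdiff {T : A} {σ : Set ℍ[ℝ]} (hσ : IsSSpectralSet T σ) :
    IsClosed (sSpectrum T \ σ) := by
  have h := (isClosed_sSpectrum T).isClosedMap_subtype_val _ hσ.isClopen.compl.isClosed
  rwa [← preimage_compl, Subtype.image_preimage_coe] at h

theorem IsSSpectralSet.isCompact_sliceSet {T : A} {σ : Set ℍ[ℝ]} (hσ : IsSSpectralSet T σ)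
    {I : ℍ[ℝ]} (hI : I ∈ imagUnits) : IsCompact (sliceSet I σ) :=
  (isCompact_planarSpectrum T).of_isClosed_subset
    (hσ.isClosed.preimage (continuous_slicePoint I))
    ((preimage_mono hσ.subset).trans (sliceSet_sSpectrum T hI).subset)

theorem IsSSpectralSet.isClosed_planarSpectrum_sdiff {T : A} {σ : Set ℍ[ℝ]}
    (hσ : IsSSpectralSet T σ) {I : ℍ[ℝ]} (hI : I ∈ imagUnits) :
    IsClosed (planarSpectrum T \ sliceSet I σ) := by
  rw [← sliceSet_sSpectrum T hI]
  exact hσ.isClosed_sdiff.preimage (continuous_slicePoint I)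

theorem IsSSpectralSet.exists_cutoff {T : A} {σ : Set ℍ[ℝ]} (hσ : IsSSpectralSet T σ)
    {I : ℍ[ℝ]} (hI : I ∈ imagUnits) : ∃ χ, IsSpectralCutoff T (sliceSet I σ) χ :=
  exists_isSpectralCutoff (hσ.isCompact_sliceSet hI) (hσ.isClosed_planarSpectrum_sdiff hI)
    fun _ hz => hσ.axiallySymmetric.conj_mem_sliceSet hI hz

theorem IsSSpectralSet.exists_isRieszContour {T : A} {σ : Set ℍ[ℝ]} (hσ : IsSSpectralSet T σ) :
    ∃ (Ω : Set ℍ[ℝ]) (n : ℕ) (γ : Fin n → ℝ → ℂ), IsRieszContour T σ Ω γ := by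
  obtain ⟨I₀, hI₀⟩ := exists_imagUnit
  obtain ⟨D, n, γ, hDo, hDb, hσD, hDc, hDL, hγ⟩ := exists_orientedBoundary
    (hσ.isCompact_sliceSet hI₀) (hσ.isClosed_planarSpectrum_sdiff hI₀) disjoint_sdiff_right
    fun _ hz => hσ.axiallySymmetric.conj_mem_sliceSet hI₀ hz
  have hax := axiallySymmetric_axialHull D
  have hclosure : ∀ z ∈ closure D, z ∈ planarSpectrum T → z ∈ sliceSet I₀ σ := fun z hz hzT => by
    by_contra h
    exact disjoint_left.mp hDL hz ⟨hzT, h⟩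
  refine ⟨axialHull D, n, γ, hDo.preimage continuous_axialCoordinate, ?_, hax, ?_, ?_, ?_⟩
  · obtain ⟨R, hR⟩ := hDb.subset_closedBall 0
    refine (Metric.isBounded_closedBall (x := (0 : ℍ[ℝ])) (r := R)).subset fun q hq => ?_
    have := mem_closedBall_zero_iff.mp (hR hq)
    rwa [norm_axialCoordinate, ← mem_closedBall_zero_iff] at this
  · ext q
    constructor
    · rintro ⟨hq, hqT⟩
      refine (hσ.axiallySymmetric.mem_sliceSet_iff hI₀ q).mp (hclosure _ (subset_closure hq) ?_)
      rw [← sliceSet_sSpectrum T hI₀]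
      exact ((axiallySymmetric_sSpectrum T).mem_sliceSet_iff hI₀ q).mpr hqT
    · exact fun hq => ⟨hσD ((hσ.axiallySymmetric.mem_sliceSet_iff hI₀ q).mpr hq), hσ.subset hq⟩
  · intro I hI z hz hzT
    rw [sliceSet_axialHull hDc hI] at hz
    have hzT' : z ∈ planarSpectrum T := by
      rw [← sliceSet_sSpectrum T hI]
      exact hzT
    refine hz.2 ?_
    rw [hDo.interior_eq]
    exact hσD (hclosure z hz.1 hzT')
  · intro I hI
    rwa [sliceSet_axialHull hDc hI]

/-- The choice in the definition of the Riesz projector is immaterial. -/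
theorem rieszProjector_eq_rieszElement {ι : ℍ[ℝ] →ₐ[ℝ] A} (hι : ∀ s, ‖ι s‖ ≤ ‖s‖) {T : A}
    {σ : Set ℍ[ℝ]} (hσ : IsSSpectralSet T σ) {I : ℍ[ℝ]} (hI : I ∈ imagUnits) {χ : ℂ → ℝ}
    (hχ : IsSpectralCutoff T (sliceSet I σ) χ) : rieszProjector ι T σ = rieszElement T χ := by
  obtain ⟨Ω₀, n₀, γ₀, h₀⟩ := hσ.exists_isRieszContour
  obtain ⟨Ω, n, γ, J, hJ, hΩ, hP⟩ := Classical.epsilon_spec (p := fun P : A =>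
    ∃ (Ω : Set ℍ[ℝ]) (n : ℕ) (γ : Fin n → ℝ → ℂ), ∃ I ∈ imagUnits,
    IsRieszContour T σ Ω γ ∧ rieszIntegral ι T I γ = P) ⟨_, Ω₀, n₀, γ₀, I, hI, h₀, rfl⟩
  rw [hσ.axiallySymmetric.sliceSet_eq hI hJ] at hχ
  rw [rieszProjector, ← hP]
  exact rieszIntegral_eq_rieszElement hι hΩ hJ hχ

/-- The properties of the Riesz projectors in a real Banach algebra that contains the
quaternions. -/
theorem rieszProjector_properties {ι : ℍ[ℝ] →ₐ[ℝ] A} (hι : ∀ s, ‖ι s‖ ≤ ‖s‖) (T : A) :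
    (∀ σ, IsSSpectralSet T σ →
      (∃ (Ω : Set ℍ[ℝ]) (n : ℕ) (γ : Fin n → ℝ → ℂ), IsRieszContour T σ Ω γ) ∧
      ∀ (Ω : Set ℍ[ℝ]) (n : ℕ) (γ : Fin n → ℝ → ℂ), IsRieszContour T σ Ω γ →
        ∀ I ∈ imagUnits, rieszProjector ι T σ = rieszIntegral ι T I γ) ∧
    (∀ σ, IsSSpectralSet T σ → T * rieszProjector ι T σ = rieszProjector ι T σ * T) ∧
    rieszProjector ι T (sSpectrum T) = 1 ∧
    rieszProjector ι T ∅ = 0 ∧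
    (∀ σ δ, IsSSpectralSet T σ → IsSSpectralSet T δ → σ ∩ δ = ∅ →
      rieszProjector ι T (σ ∪ δ) = rieszProjector ι T σ + rieszProjector ι T δ) ∧
    (∀ σ δ, IsSSpectralSet T σ → IsSSpectralSet T δ →
      rieszProjector ι T (σ ∩ δ) = rieszProjector ι T σ * rieszProjector ι T δ) := by
  obtain ⟨I₀, hI₀⟩ := exists_imagUnit
  let I : imagUnits := ⟨I₀, hI₀⟩
  have hP : ∀ {σ χ}, IsSSpectralSet T σ → IsSpectralCutoff T (sliceSet I₀ σ) χ →
      rieszProjector ι T σ = rieszElement T χ := fun hσ hχ =>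
    rieszProjector_eq_rieszElement hι hσ hI₀ hχ
  have hinj := sliceLeft_injective (hι := hι) (I := I)
  refine ⟨fun σ hσ => ⟨hσ.exists_isRieszContour, fun Ω n γ hγ J hJ => ?_⟩, fun σ hσ => ?_, ?_, ?_,
    fun σ δ hσ hδ hd => ?_, fun σ δ hσ hδ => ?_⟩
  · obtain ⟨χ, hχ⟩ := hσ.exists_cutoff hJ
    rw [rieszProjector_eq_rieszElement hι hσ hJ hχ, rieszIntegral_eq_rieszElement hι hγ hJ hχ]
  · obtain ⟨χ, hχ⟩ := hσ.exists_cutoff hI₀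
    rw [hP hσ hχ]
    apply hinj
    rw [map_mul, map_mul, sliceLeft_rieszElement hχ]
    exact commute_planarCalculus hχ.isCutoff
  · obtain ⟨χ, hχ⟩ := (isSSpectralSet_sSpectrum T).exists_cutoff hI₀
    rw [hP (isSSpectralSet_sSpectrum T) hχ]
    apply hinj
    rw [map_one, sliceLeft_rieszElement hχ]
    refine planarCalculus_eq_one hχ.isCutoff fun z hz => ?_
    have hz' := spectrum_sliceLeft_subset T hz
    filter_upwards [hχ.eventually_one z hz' ((sliceSet_sSpectrum T hI₀).symm.subset hz')] with w hw
    simp [hw]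
  · rw [hP (isSSpectralSet_empty T) (isSpectralCutoff_zero T)]
    simp [rieszElement, cutoffDensity]
  · obtain ⟨χ, hχ⟩ := hσ.exists_cutoff hI₀
    obtain ⟨ψ, hψ⟩ := hδ.exists_cutoff hI₀
    have hsum := hχ.add hψ ((disjoint_iff_inter_eq_empty.mpr hd).preimage (slicePoint I₀))
    rw [hP hσ hχ, hP hδ hψ, hP (hσ.union hδ) hsum]
    apply hinj
    rw [map_add, sliceLeft_rieszElement hχ, sliceLeft_rieszElement hψ,
      sliceLeft_rieszElement hsum, ← planarCalculus_add hχ.isCutoff hψ.isCutoff]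
    simp only [Complex.ofReal_add]
  · obtain ⟨χ, hχ⟩ := hσ.exists_cutoff hI₀
    obtain ⟨ψ, hψ⟩ := hδ.exists_cutoff hI₀
    have hmul := hχ.mul hψ
    rw [hP hσ hχ, hP hδ hψ, hP (hσ.inter hδ) hmul]
    apply hinj
    rw [map_mul, sliceLeft_rieszElement hχ, sliceLeft_rieszElement hψ,
      sliceLeft_rieszElement hmul, ← planarCalculus_mul hχ.isCutoff hψ.isCutoff]
    simp only [Complex.ofReal_mul]

end Projector

section Transfer

variable {A A' : Type*} [NormedRing A] [NormedAlgebra ℝ A] [NormedRing A'] [NormedAlgebra ℝ A']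

theorem IsSSpectralSet.of_sSpectrum_eq {T : A} {T' : A'} {σ : Set ℍ[ℝ]}
    (hσ : IsSSpectralSet T σ) (h : sSpectrum T = sSpectrum T') : IsSSpectralSet T' σ := by
  obtain ⟨h1, h2, h3⟩ := hσ
  exact ⟨h ▸ h1, h2, h ▸ h3⟩

theorem IsRieszContour.of_sSpectrum_eq {T : A} {T' : A'} {σ Ω : Set ℍ[ℝ]} {n : ℕ}
    {γ : Fin n → ℝ → ℂ} (hγ : IsRieszContour T σ Ω γ) (h : sSpectrum T = sSpectrum T') :
    IsRieszContour T' σ Ω γ where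
  isOpen := hγ.isOpen
  isBounded := hγ.isBounded
  axiallySymmetric := hγ.axiallySymmetric
  inter_sSpectrum := h ▸ hγ.inter_sSpectrum
  frontier_subset := by
    have h1 := hγ.frontier_subset
    simp only [sResolventSet] at h1 ⊢
    rwa [h] at h1
  isOrientedBoundary := hγ.isOrientedBoundary

theorem sSpectrum_op (T : A) : sSpectrum (op T) = sSpectrum T := by
  ext s
  have h : sPoly (op T) s = op (sPoly T s) := by simp [sPoly]
  change ¬ IsUnit (sPoly (op T) s) ↔ ¬ IsUnit (sPoly T s)
  rw [h, isUnit_op]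

end Transfer

section Operators

theorem completeSpace_boundedRight (V : Type*) [NormedAddCommGroup V] [NormedSpace ℝ V]
    [Module ℍ[ℝ]ᵐᵒᵖ V] [IsScalarTower ℝ ℍ[ℝ]ᵐᵒᵖ V] [IsBoundedSMul ℍ[ℝ]ᵐᵒᵖ V] [CompleteSpace V] :
    CompleteSpace (BoundedRight V) := by
  have h : IsClosed ((BoundedRight V : Subalgebra ℝ (V →L[ℝ] V)) : Set (V →L[ℝ] V)) := by
    change IsClosed {f : V →L[ℝ] V | ∀ (a : ℍ[ℝ]) (v : V), f (op a • v) = op a • f v}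
    simp only [ofPred_forall]
    refine isClosed_iInter fun a => isClosed_iInter fun v => isClosed_eq ?_ ?_
    · exact (ContinuousLinearMap.apply ℝ V (op a • v)).continuous
    · exact (ContinuousLinearMap.apply ℝ V v).continuous.const_smul (op a)
  exact h.completeSpace_coe

theorem completeSpace_boundedLeft (V : Type*) [NormedAddCommGroup V] [NormedSpace ℝ V]
    [Module ℍ[ℝ] V] [IsScalarTower ℝ ℍ[ℝ] V] [IsBoundedSMul ℍ[ℝ] V] [CompleteSpace V] :
    CompleteSpace (BoundedLeft V) := by
  have h : IsClosed ((BoundedLeft V : Subalgebra ℝ (V →L[ℝ] V)) : Set (V →L[ℝ] V)) := by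
    change IsClosed {f : V →L[ℝ] V | ∀ (a : ℍ[ℝ]) (v : V), f (a • v) = a • f v}
    simp only [ofPred_forall]
    refine isClosed_iInter fun a => isClosed_iInter fun v => isClosed_eq ?_ ?_
    · exact (ContinuousLinearMap.apply ℝ V (a • v)).continuous
    · exact (ContinuousLinearMap.apply ℝ V v).continuous.const_smul a
  exact h.completeSpace_coe

variable (V : Type*) [NormedAddCommGroup V] [NormedSpace ℝ V]
  [Module ℍ[ℝ] V] [Module ℍ[ℝ]ᵐᵒᵖ V] [SMulCommClass ℍ[ℝ] ℍ[ℝ]ᵐᵒᵖ V]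
  [IsScalarTower ℝ ℍ[ℝ] V] [IsScalarTower ℝ ℍ[ℝ]ᵐᵒᵖ V]

theorem norm_scalarRight_le [IsBoundedSMul ℍ[ℝ] V] (s : ℍ[ℝ]) : ‖scalarRight V s‖ ≤ ‖s‖ :=
  ContinuousLinearMap.opNorm_le_bound _ (norm_nonneg s) fun v => norm_smul_le s v

theorem norm_scalarLeft_le [IsBoundedSMul ℍ[ℝ]ᵐᵒᵖ V] (s : ℍ[ℝ]) : ‖scalarLeft V s‖ ≤ ‖s‖ :=
  ContinuousLinearMap.opNorm_le_bound _ (norm_nonneg s) fun v => norm_smul_le (op s) v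

end Operators

end QuatRiesz

end

open QuatRiesz MulOpposite in
theorem theorem2 (V : Type*) [NormedAddCommGroup V] [NormedSpace ℝ V] [CompleteSpace V]
    [Module ℍ[ℝ] V] [Module ℍ[ℝ]ᵐᵒᵖ V] [SMulCommClass ℍ[ℝ] ℍ[ℝ]ᵐᵒᵖ V]
    [IsScalarTower ℝ ℍ[ℝ] V] [IsScalarTower ℝ ℍ[ℝ]ᵐᵒᵖ V]
    [IsBoundedSMul ℍ[ℝ] V] [IsBoundedSMul ℍ[ℝ]ᵐᵒᵖ V] :
    -- right linear operators
    (∀ (T : BoundedRight V) (P : Set ℍ[ℝ] → BoundedRight V),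
      P = rieszProjector (scalarRight V) T →
      (∀ σ, IsSSpectralSet T σ →
        (∃ (Ω : Set ℍ[ℝ]) (n : ℕ) (γ : Fin n → ℝ → ℂ), IsRieszContour T σ Ω γ) ∧
        ∀ (Ω : Set ℍ[ℝ]) (n : ℕ) (γ : Fin n → ℝ → ℂ), IsRieszContour T σ Ω γ →
          ∀ I ∈ imagUnits, P σ = rieszIntegral (scalarRight V) T I γ) ∧
      (∀ σ, IsSSpectralSet T σ → P σ ^ 2 = P σ) ∧
      (∀ σ, IsSSpectralSet T σ → T * P σ = P σ * T) ∧
      P (sSpectrum T) = 1 ∧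
      P ∅ = 0 ∧
      (∀ σ δ, IsSSpectralSet T σ → IsSSpectralSet T δ → σ ∩ δ = ∅ →
        P (σ ∪ δ) = P σ + P δ) ∧
      (∀ σ δ, IsSSpectralSet T σ → IsSSpectralSet T δ → P (σ ∩ δ) = P σ * P δ)) ∧
    -- left linear operators
    (∀ (T : BoundedLeft V) (P : Set ℍ[ℝ] → BoundedLeft V),
      (P = fun σ => unop (rieszProjector (scalarLeft V) (op T) σ)) →
      (∀ σ, IsSSpectralSet T σ →
        (∃ (Ω : Set ℍ[ℝ]) (n : ℕ) (γ : Fin n → ℝ → ℂ), IsRieszContour T σ Ω γ) ∧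
        ∀ (Ω : Set ℍ[ℝ]) (n : ℕ) (γ : Fin n → ℝ → ℂ), IsRieszContour T σ Ω γ →
          ∀ I ∈ imagUnits, P σ = unop (rieszIntegral (scalarLeft V) (op T) I γ)) ∧
      (∀ σ, IsSSpectralSet T σ → P σ ^ 2 = P σ) ∧
      (∀ σ, IsSSpectralSet T σ → T * P σ = P σ * T) ∧
      P (sSpectrum T) = 1 ∧
      P ∅ = 0 ∧
      (∀ σ δ, IsSSpectralSet T σ → IsSSpectralSet T δ → σ ∩ δ = ∅ →
        P (σ ∪ δ) = P σ + P δ) ∧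
      (∀ σ δ, IsSSpectralSet T σ → IsSSpectralSet T δ → P (σ ∩ δ) = P σ * P δ)) := by
  constructor
  · rintro T P rfl
    have := completeSpace_boundedRight V
    obtain ⟨h1, h2, h3, h4, h5, h6⟩ := rieszProjector_properties (norm_scalarRight_le V) T
    refine ⟨h1, fun σ hσ => ?_, h2, h3, h4, h5, h6⟩
    rw [sq, ← h6 σ σ hσ hσ, Set.inter_self]
  · rintro T P rfl
    have := completeSpace_boundedLeft V
    have hT := sSpectrum_op T
    obtain ⟨h1, h2, h3, h4, h5, h6⟩ := rieszProjector_properties (norm_scalarLeft_le V) (op T)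
    have hS : ∀ {σ}, IsSSpectralSet T σ → IsSSpectralSet (op T) σ := fun hσ =>
      hσ.of_sSpectrum_eq hT.symm
    -- the algebra of the left linear case is opposite, and Riesz projectors commute
    have hmul : ∀ σ δ, IsSSpectralSet T σ → IsSSpectralSet T δ →
        unop (rieszProjector (scalarLeft V) (op T) (σ ∩ δ)) =
        unop (rieszProjector (scalarLeft V) (op T) σ) *
        unop (rieszProjector (scalarLeft V) (op T) δ) := fun σ δ hσ hδ => by
      rw [Set.inter_comm, h6 δ σ (hS hδ) (hS hσ), unop_mul]
    refine ⟨fun σ hσ => ⟨?_, fun Ω n γ hγ I hI => ?_⟩, fun σ hσ => ?_, fun σ hσ => ?_, ?_, ?_,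
      fun σ δ hσ hδ hd => ?_, hmul⟩
    · obtain ⟨Ω, n, γ, hγ⟩ := (h1 σ (hS hσ)).1
      exact ⟨Ω, n, γ, hγ.of_sSpectrum_eq hT⟩
    · exact congrArg unop ((h1 σ (hS hσ)).2 Ω n γ (hγ.of_sSpectrum_eq hT.symm) I hI)
    · have h := hmul σ σ hσ hσ
      rw [Set.inter_self] at h
      rw [sq, ← h]
    · exact (congrArg unop (h2 σ (hS hσ))).symm
    · exact (congrArg (fun σ => unop (rieszProjector (scalarLeft V) (op T) σ)) hT.symm).trans
        (congrArg unop h3)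
    · exact congrArg unop h4
    · exact congrArg unop (h5 σ δ (hS hσ) (hS hδ) hd)
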